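/- Let $n\ge 0$, $A=\mathbb C[x_1,\dots,x_n]$, and let $R$ be one of the following filtered rings of differential operators: (i) $R=A[\partial_1,\dots,\partial_n]$ (the Weyl algebra) with the filtration $F_\bullet R$ by order, so that $\operatorname{Gr}R=A[\xi_1,\dots,\xi_n]$, $\xi_i=\sigma_1(\partial_i)$; or (ii) $R=A[\partial_1,\dots,\partial_n][s]$, with $s$ a central variable, and the total order filtration, in which $A$ has order $0$ and $\partial_1,\dots,\partial_n,s$ have order $1$, so that $\operatorname{Gr}R=A[\xi_1,\dots,\xi_n,s]$. For $P\in F_kR$ let $\sigma_k(P)\in\operatorname{Gr}_kR$ be its symbol of order $k$. Then $F_1R$, with the commutator bracket and the anchor $P\mapsto (a\mapsto [P,a]\in A)$, is a Lie–Rinehart algebra over $(\mathbb C,A)$. Let $m\ge 0$ and let $r_1,\dots,r_m\in R$, and put either $o_i=1$ for all $i$, or (if $m\geq 1$) $o_1=0$ and $o_i=1$ for $i\ge 2$. Assume that $r_i\in F_{o_i}R$ for all $i$, that the symbols $\sigma_{o_1}(r_1),\dots,\sigma_{o_m}(r_m)$ are linearly independent over $A$, and that $L=\sum_i A\,r_i\subset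 F_1R$ is closed under the Lie bracket. Then $L=\bigoplus_i A\,r_i$ is a Lie–Rinehart algebra over $(\mathbb C,A)$; let $U(L)$ be its enveloping algebra. Let $\mathrm{Sp}^\bullet_L$ be the Spencer complex of left $U(L)$-modules, $\mathrm{Sp}^{-e}_L=U(L)\otimes_A\bigwedge^e_A L$ for $e\geq 0$, with $d(P\otimes\lambda)=P\lambda$ for $e=1$ and, for $e\ge 2$, $$d\bigl(P\otimes(\lambda_1\wedge\dots\wedge\lambda_e)\bigr)=\sum_{i=1}^e(-1)^{i-1}P\lambda_i\otimes(\lambda_1\wedge\cdots\widehat{\lambda_i}\cdots\wedge\lambda_e)+\sum_{1\le i<j\le e}(-1)^{i+j}P\otimes([\lambda_i,\lambda_j]\wedge\lambda_1\wedge\cdots\widehat{\lambda_i}\cdots\widehat{\lambda_j}\cdots\wedge\lambda_e),$$ and let $\mathrm{Sp}^\bullet_{R,\underline r}=R\otimes_{U(L)}\mathrm{Sp}^\bullet_L$, where $U(L)\to R$ is induced by the inclusion $L\subset F_1R$. Assume that $\sigma_{o_1}(r_1),\dots,\sigma_{o_m}(r_m)$ is a regular sequence in $\operatorname{Gr}R$,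 in the weak sense that for every $i$ multiplication by $\sigma_{o_i}(r_i)$ is injective on $\operatorname{Gr}R/(\sigma_{o_1}(r_1),\dots,\sigma_{o_{i-1}}(r_{i-1}))$. Then: 1. $\mathrm{Sp}^\bullet_{R,\underline r}$ is a complex of free left $R$-modules that is exact in degrees $\ne 0$, and the augmentation $\mathrm{Sp}^0_{R,\underline r}=R\to R/R\langle r_1,\dots,r_m\rangle$ identifies its $0$-th cohomology with $R/R\langle r_1,\dots,r_m\rangle$; i.e. it is a free resolution of the left $R$-module $R/R\langle r_1,\dots,r_m\rangle$. 2. $\{r_1,\dots,r_m\}$ is an involutive basis of the left ideal $I=R\langle r_1,\dots,r_m\rangle$: the ideal $\sigma(I)$ of $\operatorname{Gr}R$ generated by the symbols of all elements of $I$ is generated by $\sigma_{o_1}(r_1),\dots,\sigma_{o_m}(r_m)$. -/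

import Mathlib

open MvPolynomial

namespace SpencerResolution

noncomputable section

/-! ### The rings of differential operators `ℂ[x][∂]` and `ℂ[x][∂][s]` -/

/-- The polynomial ring `ℂ[x] = ℂ[x₁, …, xₙ]`. -/
abbrev PolyRing (n : ℕ) : Type := MvPolynomial (Fin n) ℂ

/-- The polynomial ring `ℂ[x₁, …, xₙ, s₁, …, s_p]` on which the operators act. -/
abbrev BigPoly (n p : ℕ) : Type := MvPolynomial (Fin n ⊕ Fin p) ℂ

/-- The algebra of operators on `ℂ[x, s]` generated by the multiplications by the variables `xᵢ`
and `sⱼ` and by the partial derivatives `∂ᵢ = ∂/∂xᵢ`.  For `p = 0` this is the Weyl algebra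
`ℂ[x][∂]`, for `p = 1` it is `ℂ[x][∂][s]`, with `s` a central variable. -/
def diffOpSubalgebra (n p : ℕ) : Subalgebra ℂ (Module.End ℂ (BigPoly n p)) :=
  Algebra.adjoin ℂ
    (Set.range (fun v : Fin n ⊕ Fin p => Algebra.lmul ℂ (BigPoly n p) (X v)) ∪
      Set.range (fun i : Fin n =>
        ((pderiv (R := ℂ) (Sum.inl i : Fin n ⊕ Fin p) :
          Derivation ℂ (BigPoly n p) (BigPoly n p)) : BigPoly n p →ₗ[ℂ] BigPoly n p)))

/-- The ring `R` of differential operators: `ℂ[x][∂]` for `p = 0`, `ℂ[x][∂][s]` for `p = 1`. -/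
def DiffOp (n p : ℕ) : Type := ↥(diffOpSubalgebra n p)

variable {n p : ℕ}

instance : Ring (DiffOp n p) := inferInstanceAs (Ring ↥(diffOpSubalgebra n p))
instance : Algebra ℂ (DiffOp n p) := inferInstanceAs (Algebra ℂ ↥(diffOpSubalgebra n p))

/-- The inclusion of `R` in the operators on `ℂ[x, s]`. -/
def toEnd (n p : ℕ) : DiffOp n p →ₐ[ℂ] Module.End ℂ (BigPoly n p) := (diffOpSubalgebra n p).val

theorem toEnd_injective : Function.Injective (toEnd n p) := Subtype.val_injective

theorem lmul_mem (q : BigPoly n p) : Algebra.lmul ℂ (BigPoly n p) q ∈ diffOpSubalgebra n p := by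
  induction q using MvPolynomial.induction_on with
  | C a =>
    have : Algebra.lmul ℂ (BigPoly n p) (C a) = algebraMap ℂ _ a := by
      ext; simp [← MvPolynomial.algebraMap_eq]
    rw [this]
    exact Subalgebra.algebraMap_mem _ a
  | add f g hf hg => rw [map_add]; exact add_mem hf hg
  | mul_X f v hf =>
    rw [map_mul]
    exact mul_mem hf (Algebra.subset_adjoin (Or.inl ⟨v, rfl⟩))

/-- Polynomials in `x` as differential operators of order `0`. -/
def ofPoly (n p : ℕ) : PolyRing n →ₐ[ℂ] DiffOp n p :=
  ((Algebra.lmul ℂ (BigPoly n p)).comp (rename Sum.inl)).codRestrict (diffOpSubalgebra n p)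
    (fun _ => lmul_mem _)

@[simp] theorem toEnd_ofPoly (a : PolyRing n) (f : BigPoly n p) :
    toEnd n p (ofPoly n p a) f = rename Sum.inl a * f := rfl

/-- `R` as a left `ℂ[x]`-module. -/
instance : Module (PolyRing n) (DiffOp n p) := Module.compHom _ (ofPoly n p).toRingHom

theorem poly_smul_def (a : PolyRing n) (P : DiffOp n p) : a • P = ofPoly n p a * P := rfl

instance : IsScalarTower ℂ (PolyRing n) (DiffOp n p) where
  smul_assoc c a P := by simp [poly_smul_def]

/-- The generators of positive order: `∂ᵢ` and `sⱼ`. -/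
def gen : Fin n ⊕ Fin p → DiffOp n p
  | Sum.inl i => ⟨_, Algebra.subset_adjoin (Or.inr ⟨i, rfl⟩)⟩
  | Sum.inr j => ⟨_, Algebra.subset_adjoin (Or.inl ⟨Sum.inr j, rfl⟩)⟩

@[simp] theorem toEnd_gen_inl (i : Fin n) (f : BigPoly n p) :
    toEnd n p (gen (Sum.inl i)) f = pderiv (Sum.inl i) f := rfl

@[simp] theorem toEnd_gen_inr (j : Fin p) (f : BigPoly n p) :
    toEnd n p (gen (Sum.inr j)) f = X (Sum.inr j) * f := rfl

theorem pderiv_pderiv_swap {σ : Type*} (i j : σ) (f : MvPolynomial σ ℂ) :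
    pderiv i (pderiv j f) = pderiv j (pderiv i f) := by
  have h : (⁅(pderiv i : Derivation ℂ (MvPolynomial σ ℂ) (MvPolynomial σ ℂ)), pderiv j⁆ :
      Derivation ℂ (MvPolynomial σ ℂ) (MvPolynomial σ ℂ)) = 0 := by
    classical
    refine MvPolynomial.derivation_ext fun k => ?_
    simp [Derivation.commutator_apply, pderiv_X, Pi.single_apply, apply_ite]
  have := congrArg (fun D : Derivation ℂ (MvPolynomial σ ℂ) (MvPolynomial σ ℂ) => D f) h
  simpa [Derivation.commutator_apply, sub_eq_zero] using this

theorem gen_commute (v w : Fin n ⊕ Fin p) : Commute (gen v) (gen w) := by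
  apply toEnd_injective
  refine LinearMap.ext fun f => ?_
  rw [map_mul, map_mul, Module.End.mul_apply, Module.End.mul_apply]
  rcases v with i | j <;> rcases w with i' | j'
  · simp [pderiv_pderiv_swap (Sum.inl i)]
  · simp
  · simp
  · simp [mul_left_comm]

theorem gen_pow_pairwise (α : Fin n ⊕ Fin p → ℕ) :
    ((Finset.univ : Finset (Fin n ⊕ Fin p)) : Set (Fin n ⊕ Fin p)).Pairwise
      (Function.onFun Commute fun v => gen v ^ α v) :=
  fun v _ w _ _ => (gen_commute v w).pow_pow _ _

/-- The monomial `∂^α s^β`, for the multi-index `(α, β)`. -/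
def opMonomial (α : Fin n ⊕ Fin p →₀ ℕ) : DiffOp n p :=
  Finset.univ.noncommProd (fun v => gen v ^ α v) (gen_pow_pairwise α)

@[simp] theorem opMonomial_zero : opMonomial (0 : Fin n ⊕ Fin p →₀ ℕ) = 1 := by
  unfold opMonomial
  rw [Finset.noncommProd_eq_pow_card _ _ _ 1 (by simp)]
  simp

theorem opMonomial_add (α β : Fin n ⊕ Fin p →₀ ℕ) :
    opMonomial (α + β) = opMonomial α * opMonomial β := by
  unfold opMonomial
  rw [← Finset.noncommProd_mul_distrib _ _ (gen_pow_pairwise α) (gen_pow_pairwise β)]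
  · exact Finset.noncommProd_congr rfl (fun v _ => by simp [pow_add]) _
  · exact fun v _ w _ _ => (gen_commute v w).pow_pow _ _

theorem opMonomial_single (v : Fin n ⊕ Fin p) : opMonomial (Finsupp.single v 1) = gen v := by
  classical
  unfold opMonomial
  rw [← Finset.noncommProd_erase_mul Finset.univ (Finset.mem_univ v) _ (gen_pow_pairwise _)
    ((gen_pow_pairwise _).mono (by simp)), Finset.noncommProd_eq_pow_card _ _ _ 1]
  · simp
  · intro w hw
    simp [(Finset.ne_of_mem_erase hw).symm]

/-! ### The normal form and the symbols -/

/-- The associated graded ring `Gr R = ℂ[x][ξ₁, …, ξₙ, s₁, …, s_p]`, with `ξᵢ` the class of `∂ᵢ`;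
the `ξᵢ` and the `sⱼ` have degree `1`. -/
abbrev GrRing (n p : ℕ) : Type := MvPolynomial (Fin n ⊕ Fin p) (PolyRing n)

/-- The `ℂ[x]`-linear map `Gr R → R` that sends `ξ^α s^β` to `∂^α s^β`. -/
def quantize (n p : ℕ) : GrRing n p →ₗ[PolyRing n] DiffOp n p :=
  (MvPolynomial.basisMonomials (Fin n ⊕ Fin p) (PolyRing n)).constr ℕ opMonomial

theorem quantize_monomial (α : Fin n ⊕ Fin p →₀ ℕ) (a : PolyRing n) :
    quantize n p (monomial α a) = a • opMonomial α := by
  have h : quantize n p (monomial α 1) = opMonomial α := by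
    have := (MvPolynomial.basisMonomials (Fin n ⊕ Fin p) (PolyRing n)).constr_basis ℕ
      (opMonomial (n := n) (p := p)) α
    rwa [MvPolynomial.coe_basisMonomials] at this
  rw [← h, ← map_smul, MvPolynomial.smul_monomial, smul_eq_mul, mul_one]

theorem quantize_C (a : PolyRing n) : quantize n p (C a) = ofPoly n p a := by
  rw [C_apply, quantize_monomial, opMonomial_zero, poly_smul_def, mul_one]

theorem quantize_mul_X (P : GrRing n p) (v : Fin n ⊕ Fin p) :
    quantize n p (P * X v) = quantize n p P * gen v := by
  induction P using MvPolynomial.induction_on' with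
  | monomial α a =>
    rw [X, monomial_mul, mul_one, quantize_monomial, quantize_monomial, opMonomial_add,
      opMonomial_single, poly_smul_def, poly_smul_def, mul_assoc]
  | add P Q hP hQ => rw [add_mul, map_add, hP, hQ, map_add, add_mul]

theorem gen_inl_mul_ofPoly (i : Fin n) (a : PolyRing n) :
    gen (p := p) (Sum.inl i) * ofPoly n p a
      = ofPoly n p a * gen (Sum.inl i) + ofPoly n p (pderiv i a) := by
  apply toEnd_injective
  refine LinearMap.ext fun f => ?_
  simp only [map_mul, map_add, Module.End.mul_apply, LinearMap.add_apply, toEnd_ofPoly,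
    toEnd_gen_inl, Derivation.leibniz, smul_eq_mul]
  rw [pderiv_rename Sum.inl_injective]
  ring

theorem gen_inr_commute (j : Fin p) (P : DiffOp n p) : Commute (gen (Sum.inr j)) P := by
  apply toEnd_injective
  rw [map_mul, map_mul]
  have hP : toEnd n p P ∈ diffOpSubalgebra n p := P.2
  generalize toEnd n p P = P at hP ⊢
  unfold diffOpSubalgebra at hP
  induction hP using Algebra.adjoin_induction with
  | mem P hP =>
    refine LinearMap.ext fun f => ?_
    rcases hP with ⟨v, rfl⟩ | ⟨i, rfl⟩
    · simp [mul_left_comm]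
    · simp
  | algebraMap c => exact (Algebra.commutes c _).symm
  | add P Q _ _ hP hQ => rw [mul_add, add_mul, hP, hQ]
  | mul P Q _ _ hP hQ => rw [← mul_assoc, hP, mul_assoc, hQ, mul_assoc]

theorem quantize_surjective : Function.Surjective (quantize n p) := by
  have hC : ∀ (a : PolyRing n) (Q : GrRing n p),
      ofPoly n p a * quantize n p Q = quantize n p (C a * Q) := by
    intro a Q
    rw [← smul_eq_C_mul, map_smul, poly_smul_def]
  have key : ∀ P ∈ diffOpSubalgebra n p, ∀ Q : GrRing n p, ∃ Q' : GrRing n p,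
      P * toEnd n p (quantize n p Q) = toEnd n p (quantize n p Q') := by
    intro P hP
    unfold diffOpSubalgebra at hP
    induction hP using Algebra.adjoin_induction with
    | mem P hP =>
      intro Q
      rcases hP with ⟨v | j, rfl⟩ | ⟨i, rfl⟩
      · refine ⟨C (X v) * Q, ?_⟩
        rw [← hC, map_mul]
        congr 1
        refine LinearMap.ext fun f => ?_
        simp
      · refine ⟨Q * X (Sum.inr j), ?_⟩
        rw [quantize_mul_X, ← (gen_inr_commute j _).eq, map_mul]
        rfl
      · change ∃ Q', toEnd n p (gen (Sum.inl i)) * _ = _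
        induction Q using MvPolynomial.induction_on with
        | C a =>
          refine ⟨C a * X (Sum.inl i) + C (pderiv i a), ?_⟩
          rw [← map_mul, map_add, quantize_mul_X, quantize_C, quantize_C, gen_inl_mul_ofPoly]
        | add P Q hP hQ =>
          obtain ⟨P', hP⟩ := hP
          obtain ⟨Q', hQ⟩ := hQ
          exact ⟨P' + Q', by simp only [map_add, mul_add, hP, hQ]⟩
        | mul_X P v hP =>
          obtain ⟨P', hP⟩ := hP
          exact ⟨P' * X v, by rw [quantize_mul_X, quantize_mul_X, map_mul, map_mul, ← mul_assoc, hP]⟩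
    | algebraMap c =>
      intro Q
      refine ⟨C (algebraMap ℂ _ c) * Q, ?_⟩
      rw [← hC, map_mul]
      congr 1
      refine LinearMap.ext fun f => ?_
      simp [MvPolynomial.algebraMap_eq, MvPolynomial.smul_eq_C_mul]
    | add P P' _ _ hP hP' =>
      intro Q
      obtain ⟨Q₁, h₁⟩ := hP Q
      obtain ⟨Q₂, h₂⟩ := hP' Q
      exact ⟨Q₁ + Q₂, by rw [add_mul, h₁, h₂, map_add, map_add]⟩
    | mul P P' _ _ hP hP' =>
      intro Q
      obtain ⟨Q₁, h₁⟩ := hP' Q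
      obtain ⟨Q₂, h₂⟩ := hP Q₁
      exact ⟨Q₂, by rw [mul_assoc, h₁, h₂]⟩
  intro P
  obtain ⟨Q, hQ⟩ := key (toEnd n p P) P.2 1
  refine ⟨Q, toEnd_injective ?_⟩
  rw [← hQ, ← C_1, quantize_C, map_one, map_one, mul_one]

theorem quantize_pderiv (i : Fin n) (P : GrRing n p) :
    quantize n p (pderiv (Sum.inl i) P)
      = quantize n p P * ofPoly n p (X i) - ofPoly n p (X i) * quantize n p P := by
  classical
  induction P using MvPolynomial.induction_on with
  | C a =>
    rw [quantize_C, ← map_mul, ← map_mul, mul_comm]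
    simp
  | add P Q hP hQ => rw [map_add, map_add, hP, hQ, map_add]; noncomm_ring
  | mul_X P v hP =>
    rw [Derivation.leibniz, smul_eq_mul, smul_eq_mul, map_add, mul_comm (X v), quantize_mul_X, hP,
      quantize_mul_X]
    rcases v with k | j
    · rw [pderiv_X, mul_assoc _ (gen _) (ofPoly n p _), gen_inl_mul_ofPoly, pderiv_X]
      by_cases h : k = i
      · subst h
        simp only [Pi.single_eq_same, mul_one, map_one]
        noncomm_ring
      · rw [Pi.single_eq_of_ne (by simpa using h), Pi.single_eq_of_ne (Ne.symm h)]
        simp only [mul_zero, map_zero, add_zero]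
        noncomm_ring
    · rw [pderiv_X_of_ne (by simp), mul_assoc _ (gen _) (ofPoly n p _), (gen_inr_commute j _).eq]
      simp only [mul_zero, map_zero]
      noncomm_ring

theorem quantize_apply_one (P : GrRing n p) :
    aeval (Sum.elim (fun i => (C (X i) : GrRing n p)) (fun j => X (Sum.inr j)))
        (toEnd n p (quantize n p P) 1)
      = aeval (Sum.elim (fun _ => (0 : GrRing n p)) (fun j => X (Sum.inr j))) P := by
  induction P using MvPolynomial.induction_on with
  | C a =>
    rw [quantize_C, toEnd_ofPoly, mul_one, aeval_rename, aeval_C]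
    induction a using MvPolynomial.induction_on with
    | C c => simp [MvPolynomial.algebraMap_eq, MvPolynomial.algebraMap_apply]
    | add a b ha hb => rw [map_add, map_add, ha, hb]
    | mul_X a v ha => rw [map_mul, map_mul, ha]; simp [MvPolynomial.algebraMap_eq]
  | add P Q hP hQ => simp only [map_add, LinearMap.add_apply, hP, hQ]
  | mul_X P v hP =>
    rcases v with i | j
    · rw [quantize_mul_X, map_mul, Module.End.mul_apply, toEnd_gen_inl]
      simp
    · rw [quantize_mul_X, ← (gen_inr_commute j _).eq, map_mul, Module.End.mul_apply, toEnd_gen_inr,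
        map_mul, hP, map_mul]
      simp [mul_comm]

theorem quantize_injective : Function.Injective (quantize n p) := by
  classical
  have hcoeff : ∀ (P : GrRing n p) (α : Fin n ⊕ Fin p →₀ ℕ), (∀ i, α (Sum.inl i) = 0) →
      coeff α (aeval (Sum.elim (fun _ => (0 : GrRing n p)) (fun j => X (Sum.inr j))) P)
        = coeff α P := by
    intro P
    induction P using MvPolynomial.induction_on with
    | C a => intro α _; simp [MvPolynomial.algebraMap_eq]
    | add P Q hP hQ => intro α hα; rw [map_add, coeff_add, coeff_add, hP α hα, hQ α hα]
    | mul_X P v hP =>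
      intro α hα
      rcases v with i | j
      · simp [coeff_mul_X', hα i]
      · rw [map_mul, aeval_X, Sum.elim_inr, coeff_mul_X', coeff_mul_X', hP]
        intro i
        simp [hα i]
  have key : ∀ (N : ℕ) (α : Fin n ⊕ Fin p →₀ ℕ), α.degree = N → ∀ P : GrRing n p,
      quantize n p P = 0 → coeff α P = 0 := by
    intro N
    induction N with
    | zero =>
      intro α hα P hP
      have h0 : α = 0 := (Finsupp.degree_eq_zero_iff α).mp hα
      have := quantize_apply_one P
      rw [hP] at this
      rw [← hcoeff P α (by simp [h0]), ← this]
      simp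
    | succ N ih =>
      intro α hα P hP
      by_cases h : ∀ i, α (Sum.inl i) = 0
      · have := quantize_apply_one P
        rw [hP] at this
        rw [← hcoeff P α h, ← this]
        simp
      · push Not at h
        obtain ⟨i, hi⟩ := h
        have hle : Finsupp.single (Sum.inl i) 1 ≤ α := by
          rw [Finsupp.single_le_iff]; omega
        obtain ⟨β, rfl⟩ := exists_add_of_le hle
        have h1 : quantize n p (pderiv (Sum.inl i) P) = 0 := by
          rw [quantize_pderiv, hP]; simp
        have h2 := ih β (by
          rw [map_add, Finsupp.degree_single] at hα; omega) _ h1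
        rw [coeff_pderiv] at h2
        rw [add_comm]
        refine (mul_eq_zero.mp h2).resolve_right ?_
        exact Nat.cast_add_one_ne_zero _
  rw [injective_iff_map_eq_zero]
  intro P hP
  ext1 α
  rw [coeff_zero]
  exact key _ α rfl P hP

/-- The total symbol: every `P ∈ R` is uniquely a sum `∑ a_{αβ} ∂^α s^β` with `a_{αβ} ∈ ℂ[x]`,
and its total symbol is `∑ a_{αβ} ξ^α s^β`. -/
def totalSymbol (n p : ℕ) : DiffOp n p ≃ₗ[PolyRing n] GrRing n p :=
  (LinearEquiv.ofBijective (quantize n p) ⟨quantize_injective, quantize_surjective⟩).symm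

/-- The (total) order filtration: `F_k R` is the `ℂ[x]`-span of the `∂^α s^β` with
`|α| + |β| ≤ k`. -/
def orderFiltration (n p k : ℕ) : Submodule (PolyRing n) (DiffOp n p) :=
  Submodule.span _ (opMonomial '' {α | α.degree ≤ k})

/-- The symbol `σ_k(P) ∈ Gr_k R` of an operator `P ∈ F_k R`: the homogeneous part of degree `k` of
its total symbol. -/
def symbol (k : ℕ) (P : DiffOp n p) : GrRing n p :=
  homogeneousComponent k (totalSymbol n p P)

/-- The ideal `σ(I)` of `Gr R` generated by the symbols of the elements of a left ideal `I`. -/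
def symbolIdeal (I : Submodule (DiffOp n p) (DiffOp n p)) : Ideal (GrRing n p) :=
  Ideal.span {q | ∃ (k : ℕ) (P : DiffOp n p),
    P ∈ I ∧ P ∈ orderFiltration n p k ∧ q = symbol k P}

/-! ### `F₁R` as a Lie-Rinehart algebra over `(ℂ, ℂ[x])` -/

/-- The natural left `R`-module structure on `ℂ[x]`: `P(f)`, with `s` annihilating `ℂ[x]`. -/
def actOnPoly (P : DiffOp n p) (f : PolyRing n) : PolyRing n :=
  aeval (Sum.elim X (fun _ => (0 : PolyRing n))) (toEnd n p P (rename Sum.inl f))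

theorem eq_zero_or_single_of_degree_le {σ : Type*} (α : σ →₀ ℕ) (hα : α.degree ≤ 1) :
    α = 0 ∨ ∃ v, α = Finsupp.single v 1 := by
  by_cases h : α = 0
  · exact Or.inl h
  · obtain ⟨v, hv⟩ := Finsupp.ne_iff.mp h
    have hle : Finsupp.single v 1 ≤ α := by
      rw [Finsupp.single_le_iff]; exact Nat.one_le_iff_ne_zero.mpr hv
    obtain ⟨β, rfl⟩ := exists_add_of_le hle
    rw [map_add, Finsupp.degree_single] at hα
    have : β = 0 := (Finsupp.degree_eq_zero_iff β).mp (by omega)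
    exact Or.inr ⟨v, by rw [this, add_zero]⟩

theorem exists_commutator (P : DiffOp n p) (hP : P ∈ orderFiltration n p 1) (a : PolyRing n) :
    ∃ b, P * ofPoly n p a - ofPoly n p a * P = ofPoly n p b := by
  unfold orderFiltration at hP
  induction hP using Submodule.span_induction with
  | mem P hP =>
    obtain ⟨α, hα, rfl⟩ := hP
    rcases eq_zero_or_single_of_degree_le α hα with rfl | ⟨v, rfl⟩
    · rw [opMonomial_zero]
      exact ⟨0, by simp⟩
    · rw [opMonomial_single]
      rcases v with i | j
      · exact ⟨pderiv i a, by rw [gen_inl_mul_ofPoly, add_sub_cancel_left]⟩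
      · exact ⟨0, by rw [(gen_inr_commute j _).eq, sub_self, map_zero]⟩
  | zero => exact ⟨0, by simp⟩
  | add P Q _ _ hP hQ =>
    obtain ⟨b, hb⟩ := hP
    obtain ⟨c, hc⟩ := hQ
    exact ⟨b + c, by rw [map_add, ← hb, ← hc]; noncomm_ring⟩
  | smul c P _ hP =>
    obtain ⟨b, hb⟩ := hP
    refine ⟨c * b, ?_⟩
    rw [map_mul, ← hb, poly_smul_def, mul_sub, ← mul_assoc (ofPoly n p a), ← map_mul,
      mul_comm a c, map_mul]
    noncomm_ring

theorem ofPoly_injective : Function.Injective (ofPoly n p) := by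
  intro a b h
  have h1 := congrArg (fun P => toEnd n p P 1) h
  simp only [toEnd_ofPoly, mul_one] at h1
  exact rename_injective _ Sum.inl_injective h1

theorem commutator_ofPoly (P : DiffOp n p) (hP : P ∈ orderFiltration n p 1) (a : PolyRing n) :
    ofPoly n p (actOnPoly P a - actOnPoly P 1 * a) = P * ofPoly n p a - ofPoly n p a * P := by
  obtain ⟨b, hb⟩ := exists_commutator P hP a
  rw [hb]
  congr 1
  have h1 := congrArg (fun P => toEnd n p P 1) hb
  simp only [map_sub, map_mul, LinearMap.sub_apply, Module.End.mul_apply, toEnd_ofPoly,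
    mul_one] at h1
  have hr : ∀ c : PolyRing n, aeval (Sum.elim X (fun _ : Fin p => (0 : PolyRing n)))
      (rename (Sum.inl : Fin n → Fin n ⊕ Fin p) c) = c := by
    intro c
    rw [aeval_rename, Sum.elim_comp_inl, aeval_X_left, AlgHom.id_apply]
  have h2 := congrArg (aeval (Sum.elim X (fun _ : Fin p => (0 : PolyRing n)))) h1
  rw [map_sub, map_mul, hr, hr] at h2
  rw [← h2, actOnPoly, actOnPoly, map_one, mul_comm a]

theorem one_mem_orderFiltration : (1 : DiffOp n p) ∈ orderFiltration n p 1 :=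
  Submodule.subset_span ⟨0, by simp, opMonomial_zero⟩

theorem commutator_mem {P Q : DiffOp n p} (hP : P ∈ orderFiltration n p 1)
    (hQ : Q ∈ orderFiltration n p 1) : P * Q - Q * P ∈ orderFiltration n p 1 := by
  have step : ∀ P ∈ orderFiltration n p 1,
      (∀ α : Fin n ⊕ Fin p →₀ ℕ, α.degree ≤ 1 →
        P * opMonomial α - opMonomial α * P ∈ orderFiltration n p 1) →
      ∀ Q ∈ orderFiltration n p 1, P * Q - Q * P ∈ orderFiltration n p 1 := by
    intro P hP h Q hQ
    conv at hQ => unfold orderFiltration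
    induction hQ using Submodule.span_induction with
    | mem Q hQ => obtain ⟨α, hα, rfl⟩ := hQ; exact h α hα
    | zero => simp
    | add Q Q' _ _ hQ hQ' =>
      have : P * (Q + Q') - (Q + Q') * P = (P * Q - Q * P) + (P * Q' - Q' * P) := by noncomm_ring
      rw [this]
      exact add_mem hQ hQ'
    | smul a Q hQ ih =>
      have : P * (a • Q) - (a • Q) * P
          = a • (P * Q - Q * P) + (actOnPoly P a - actOnPoly P 1 * a) • Q := by
        simp only [poly_smul_def]
        rw [commutator_ofPoly P hP]
        noncomm_ring
      rw [this]
      exact add_mem (Submodule.smul_mem _ _ ih) (Submodule.smul_mem _ _ hQ)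
  have hm : ∀ α : Fin n ⊕ Fin p →₀ ℕ, α.degree ≤ 1 → opMonomial α ∈ orderFiltration n p 1 :=
    fun α hα => Submodule.subset_span ⟨α, hα, rfl⟩
  refine step P hP (fun α hα => ?_) Q hQ
  rw [← neg_sub]
  refine neg_mem (step _ (hm α hα) (fun β _ => ?_) P hP)
  rw [← opMonomial_add, ← opMonomial_add, add_comm, sub_self]
  exact zero_mem _

/-- The module `F₁R`. -/
abbrev F1 (n p : ℕ) : Type := ↥(orderFiltration n p 1)

instance : Bracket (F1 n p) (F1 n p) where
  bracket P Q := ⟨(P : DiffOp n p) * Q - Q * P, commutator_mem P.2 Q.2⟩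

theorem F1.coe_lie (P Q : F1 n p) :
    ((⁅P, Q⁆ : F1 n p) : DiffOp n p) = (P : DiffOp n p) * Q - Q * P := rfl

/-- The Lie bracket of `F₁R` is the commutator of operators. -/
instance : LieRing (F1 n p) where
  add_lie P Q T := Subtype.ext (by simp only [F1.coe_lie, Submodule.coe_add]; noncomm_ring)
  lie_add P Q T := Subtype.ext (by simp only [F1.coe_lie, Submodule.coe_add]; noncomm_ring)
  lie_self P := Subtype.ext (by simp only [F1.coe_lie, sub_self, Submodule.coe_zero])
  leibniz_lie P Q T := Subtype.ext (by
    simp only [F1.coe_lie, Submodule.coe_add]; noncomm_ring)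

instance : LieAlgebra ℂ (F1 n p) where
  lie_smul c P Q := Subtype.ext (by
    simp only [F1.coe_lie, Submodule.coe_smul_of_tower, smul_sub, smul_mul_assoc, mul_smul_comm])

/-- The anchor: `P ∈ F₁R` acts on `ℂ[x]` through the derivation `P - P(1)`. -/
instance : Bracket (F1 n p) (PolyRing n) where
  bracket P a := actOnPoly (P : DiffOp n p) a - actOnPoly (P : DiffOp n p) 1 * a

theorem F1.ofPoly_lie (P : F1 n p) (a : PolyRing n) :
    ofPoly n p ⁅P, a⁆ = (P : DiffOp n p) * ofPoly n p a - ofPoly n p a * P :=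
  commutator_ofPoly _ P.2 a

instance : LieRingModule (F1 n p) (PolyRing n) where
  add_lie P Q a := ofPoly_injective (p := p) (by
    rw [map_add]; simp only [F1.ofPoly_lie, Submodule.coe_add]; noncomm_ring)
  lie_add P a b := ofPoly_injective (p := p) (by
    rw [map_add]; simp only [F1.ofPoly_lie, map_add]; noncomm_ring)
  leibniz_lie P Q a := ofPoly_injective (p := p) (by
    rw [map_add]; simp only [F1.ofPoly_lie, F1.coe_lie]; noncomm_ring)

instance : LieRinehartRing (PolyRing n) (F1 n p) where
  lie_smul_eq_mul' a b P := ofPoly_injective (p := p) (by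
    rw [map_mul, F1.ofPoly_lie, F1.ofPoly_lie, Submodule.coe_smul, poly_smul_def, mul_sub,
      ← mul_assoc (ofPoly n p b), ← map_mul, mul_comm b a, map_mul]
    noncomm_ring)
  leibniz_mul_right' P a b := ofPoly_injective (p := p) (by
    simp only [map_add, smul_eq_mul, map_mul, F1.ofPoly_lie]; noncomm_ring)
  leibniz_smul_right' P Q a := Subtype.ext (by
    simp only [F1.coe_lie, Submodule.coe_add, Submodule.coe_smul, poly_smul_def, F1.ofPoly_lie]
    noncomm_ring)

instance : LieRinehartAlgebra ℂ (PolyRing n) (F1 n p) where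
  smul_lie c P a := ofPoly_injective (p := p) (by
    simp only [map_smul, F1.ofPoly_lie, Submodule.coe_smul_of_tower, smul_sub, smul_mul_assoc,
      mul_smul_comm])
  lie_smul c P a := ofPoly_injective (p := p) (by
    simp only [map_smul, F1.ofPoly_lie, smul_sub, smul_mul_assoc, mul_smul_comm])

open scoped TensorProduct

/-! ### Extension of scalars along a homomorphism of noncommutative rings -/

section BaseChange

variable {B S M M' N : Type*} [Ring B] [Ring S] (φ : B →+* S)
  [AddCommGroup M] [Module B M] [AddCommGroup M'] [Module B M'] [AddCommGroup N] [Module S N]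

/-- The relations `sφ(b) ⊗ m = s ⊗ bm` in `S ⊗_ℤ M`. -/
def baseChangeRel (M : Type*) [AddCommGroup M] [Module B M] : Submodule S (S ⊗[ℤ] M) :=
  Submodule.span S {t | ∃ (s : S) (b : B) (m : M), t = (s * φ b) ⊗ₜ[ℤ] m - s ⊗ₜ[ℤ] (b • m)}

/-- The left `S`-module `S ⊗_B M`, where `S` is a right `B`-module through `φ : B → S`. -/
def BaseChange (M : Type*) [AddCommGroup M] [Module B M] : Type _ :=
  (S ⊗[ℤ] M) ⧸ baseChangeRel φ M

instance : AddCommGroup (BaseChange φ M) :=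
  inferInstanceAs (AddCommGroup ((S ⊗[ℤ] M) ⧸ baseChangeRel φ M))

instance : Module S (BaseChange φ M) :=
  inferInstanceAs (Module S ((S ⊗[ℤ] M) ⧸ baseChangeRel φ M))

/-- The element `s ⊗ m` of `S ⊗_B M`. -/
def BaseChange.mk (s : S) (m : M) : BaseChange φ M := (baseChangeRel φ M).mkQ (s ⊗ₜ[ℤ] m)

namespace BaseChange

theorem mk_add_left (s t : S) (m : M) : mk φ (s + t) m = mk φ s m + mk φ t m := by
  unfold mk; rw [TensorProduct.add_tmul]; exact map_add _ _ _

theorem mk_add_right (s : S) (m m' : M) : mk φ s (m + m') = mk φ s m + mk φ s m' := by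
  unfold mk; rw [TensorProduct.tmul_add]; exact map_add _ _ _

theorem smul_mk (s t : S) (m : M) : s • mk φ t m = mk φ (s * t) m :=
  (map_smul (baseChangeRel φ M).mkQ s (t ⊗ₜ[ℤ] m)).symm

theorem mk_mul (s : S) (b : B) (m : M) : mk φ (s * φ b) m = mk φ s (b • m) :=
  (Submodule.Quotient.eq _).mpr (Submodule.subset_span ⟨s, b, m, rfl⟩)

variable {φ}

/-- The `S`-linear map `s ⊗ m ↦ s f(m)` induced by a `φ`-semilinear map `f`. -/
def lift (f : M →ₛₗ[φ] N) : BaseChange φ M →ₗ[S] N :=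
  (baseChangeRel φ M).liftQ
    (TensorProduct.AlgebraTensorModule.lift
      (LinearMap.toSpanSingleton S (M →ₗ[ℤ] N) f.toAddMonoidHom.toIntLinearMap))
    (by
      unfold baseChangeRel
      rw [Submodule.span_le]
      rintro _ ⟨s, b, m, rfl⟩
      simp [mul_smul])

@[simp] theorem lift_mk (f : M →ₛₗ[φ] N) (s : S) (m : M) : lift f (mk φ s m) = s • f m := by
  unfold lift mk
  exact (Submodule.liftQ_apply _ _ _).trans (by simp)

theorem hom_ext {f g : BaseChange φ M →ₗ[S] N} (h : ∀ m, f (mk φ 1 m) = g (mk φ 1 m)) :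
    f = g := by
  refine Submodule.linearMap_qext _ (TensorProduct.AlgebraTensorModule.ext fun s m => ?_)
  change f (mk φ s m) = g (mk φ s m)
  rw [← mul_one s, ← smul_mk, map_smul, map_smul, h]

variable (φ)

/-- The `S`-linear map `id_S ⊗ f : S ⊗_B M → S ⊗_B M'` induced by a `B`-linear map `f`. -/
def map (f : M →ₗ[B] M') : BaseChange φ M →ₗ[S] BaseChange φ M' :=
  lift (φ := φ)
    { toFun := fun m => mk φ 1 (f m)
      map_add' := fun m m' => by rw [map_add, mk_add_right]
      map_smul' := fun b m => by rw [map_smul, ← mk_mul, one_mul, smul_mk, mul_one] }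

@[simp] theorem map_mk (f : M →ₗ[B] M') (s : S) (m : M) : map φ f (mk φ s m) = mk φ s (f m) := by
  unfold map
  rw [lift_mk]
  change s • mk φ 1 (f m) = _
  rw [smul_mk, mul_one]

end BaseChange

end BaseChange

/-! ### The enveloping algebra of a Lie-Rinehart algebra -/

section LieRinehart

variable (A L : Type*) [CommRing A] [Algebra ℂ A] [LieRing L] [LieAlgebra ℂ L] [Module A L]
  [LieRingModule L A] [LieRinehartRing A L] [LieRinehartAlgebra ℂ A L]

/-- The defining relations of the enveloping algebra of the Lie-Rinehart algebra `L`. -/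
inductive EnvRel : FreeAlgebra ℂ (A ⊕ L) → FreeAlgebra ℂ (A ⊕ L) → Prop
  | poly_add (a b : A) : EnvRel (.ι ℂ (.inl (a + b))) (.ι ℂ (.inl a) + .ι ℂ (.inl b))
  | poly_mul (a b : A) : EnvRel (.ι ℂ (.inl (a * b))) (.ι ℂ (.inl a) * .ι ℂ (.inl b))
  | poly_scalar (c : ℂ) : EnvRel (.ι ℂ (.inl (algebraMap ℂ A c))) (algebraMap ℂ _ c)
  | lie_add (x y : L) : EnvRel (.ι ℂ (.inr (x + y))) (.ι ℂ (.inr x) + .ι ℂ (.inr y))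
  | lie_smul (a : A) (x : L) : EnvRel (.ι ℂ (.inr (a • x))) (.ι ℂ (.inl a) * .ι ℂ (.inr x))
  | lie_bracket (x y : L) : EnvRel (.ι ℂ (.inr ⁅x, y⁆))
      (.ι ℂ (.inr x) * .ι ℂ (.inr y) - .ι ℂ (.inr y) * .ι ℂ (.inr x))
  | anchor (x : L) (a : A) : EnvRel (.ι ℂ (.inl ⁅x, a⁆))
      (.ι ℂ (.inr x) * .ι ℂ (.inl a) - .ι ℂ (.inl a) * .ι ℂ (.inr x))

/-- The enveloping algebra `U(L)` of the Lie-Rinehart algebra `L` over `(ℂ, A)`: the universal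
`ℂ`-algebra with an algebra homomorphism from `A` and an `A`-linear map from `L` such that
`xy - yx = [x, y]` and `xa - ax = x(a)` for `x, y ∈ L`, `a ∈ A`. -/
def EnvAlg : Type _ := RingQuot (EnvRel A L)

instance : Ring (EnvAlg A L) := inferInstanceAs (Ring (RingQuot (EnvRel A L)))
instance : Algebra ℂ (EnvAlg A L) := inferInstanceAs (Algebra ℂ (RingQuot (EnvRel A L)))

/-- The quotient map onto `U(L)`. -/
def toEnvAlg : FreeAlgebra ℂ (A ⊕ L) →ₐ[ℂ] EnvAlg A L := RingQuot.mkAlgHom ℂ (EnvRel A L)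

variable {A L}

theorem toEnvAlg_rel {u v : FreeAlgebra ℂ (A ⊕ L)} (h : EnvRel A L u v) :
    toEnvAlg A L u = toEnvAlg A L v := RingQuot.mkAlgHom_rel ℂ h

/-- The canonical homomorphism `A → U(L)`. -/
def polyToEnv (A L : Type*) [CommRing A] [Algebra ℂ A] [LieRing L] [LieAlgebra ℂ L] [Module A L]
    [LieRingModule L A] [LieRinehartRing A L] [LieRinehartAlgebra ℂ A L] : A →ₐ[ℂ] EnvAlg A L :=
  AlgHom.ofLinearMap
    { toFun := fun a => toEnvAlg A L (.ι ℂ (.inl a))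
      map_add' := fun a b => by rw [toEnvAlg_rel (.poly_add a b), map_add]
      map_smul' := fun c a => by
        rw [Algebra.smul_def, toEnvAlg_rel (.poly_mul _ a), map_mul, toEnvAlg_rel (.poly_scalar c),
          AlgHom.commutes, RingHom.id_apply, Algebra.smul_def] }
    (by
      change toEnvAlg A L (.ι ℂ (.inl 1)) = 1
      rw [← map_one (algebraMap ℂ A), toEnvAlg_rel (.poly_scalar 1), map_one, map_one])
    (fun a b => by
      change toEnvAlg A L (.ι ℂ (.inl (a * b))) = _
      rw [toEnvAlg_rel (.poly_mul a b), map_mul]; rfl)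

/-- The canonical map `L → U(L)`. -/
def lieToEnv (x : L) : EnvAlg A L := toEnvAlg A L (.ι ℂ (.inr x))

theorem lieToEnv_add (x y : L) :
    (lieToEnv (x + y) : EnvAlg A L) = lieToEnv x + lieToEnv y := by
  unfold lieToEnv; rw [toEnvAlg_rel (.lie_add x y), map_add]

theorem lieToEnv_smul (a : A) (x : L) :
    (lieToEnv (a • x) : EnvAlg A L) = polyToEnv A L a * lieToEnv x := by
  unfold lieToEnv; rw [toEnvAlg_rel (.lie_smul a x), map_mul]; rfl

theorem lieToEnv_lie (x y : L) :
    (lieToEnv ⁅x, y⁆ : EnvAlg A L) = lieToEnv x * lieToEnv y - lieToEnv y * lieToEnv x := by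
  unfold lieToEnv; rw [toEnvAlg_rel (.lie_bracket x y), map_sub, map_mul, map_mul]

theorem polyToEnv_lie (x : L) (a : A) :
    polyToEnv A L ⁅x, a⁆ = lieToEnv x * polyToEnv A L a - polyToEnv A L a * lieToEnv x := by
  change toEnvAlg A L (.ι ℂ (.inl ⁅x, a⁆)) = _
  rw [toEnvAlg_rel (.anchor x a), map_sub, map_mul, map_mul]; rfl

/-- The universal property of `U(L)`. -/
def EnvAlg.lift {S : Type*} [Ring S] [Algebra ℂ S] (f : A →ₐ[ℂ] S) (g : L → S)
    (h_add : ∀ x y, g (x + y) = g x + g y) (h_smul : ∀ (a : A) x, g (a • x) = f a * g x)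
    (h_lie : ∀ x y, g ⁅x, y⁆ = g x * g y - g y * g x)
    (h_anchor : ∀ x (a : A), f ⁅x, a⁆ = g x * f a - f a * g x) : EnvAlg A L →ₐ[ℂ] S :=
  RingQuot.liftAlgHom ℂ ⟨FreeAlgebra.lift ℂ (Sum.elim f g), by
    intro u v h
    induction h with
    | poly_add a b => simp
    | poly_mul a b => simp
    | poly_scalar c => simp
    | lie_add x y => simp [h_add]
    | lie_smul a x => simp [h_smul]
    | lie_bracket x y => simp [h_lie]
    | anchor x a => simp [h_anchor]⟩

theorem EnvAlg.lift_polyToEnv {S : Type*} [Ring S] [Algebra ℂ S] (f : A →ₐ[ℂ] S) (g : L → S)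
    (h_add h_smul h_lie h_anchor) (a : A) :
    EnvAlg.lift f g h_add h_smul h_lie h_anchor (polyToEnv A L a) = f a :=
  (RingQuot.liftAlgHom_mkAlgHom_apply ℂ _ _ _).trans (by simp)

theorem EnvAlg.lift_lieToEnv {S : Type*} [Ring S] [Algebra ℂ S] (f : A →ₐ[ℂ] S) (g : L → S)
    (h_add h_smul h_lie h_anchor) (x : L) :
    EnvAlg.lift f g h_add h_smul h_lie h_anchor (lieToEnv x) = g x :=
  (RingQuot.liftAlgHom_mkAlgHom_apply ℂ _ _ _).trans (by simp)

/-! ### The Spencer complex of a Lie-Rinehart algebra -/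

/-- The left `U(L)`-module `Sp_L^{-e} = U(L) ⊗_A Λ^e L`. -/
abbrev Sp (A L : Type*) [CommRing A] [Algebra ℂ A] [LieRing L] [LieAlgebra ℂ L] [Module A L]
    [LieRingModule L A] [LieRinehartRing A L] [LieRinehartAlgebra ℂ A L] (e : ℕ) : Type _ :=
  BaseChange (polyToEnv A L).toRingHom (⋀[A]^e L)

/-- The element `P ⊗ (v₁ ∧ ⋯ ∧ v_e)` of `Sp_L^{-e}`. -/
def Sp.mk {e : ℕ} (P : EnvAlg A L) (v : Fin e → L) : Sp A L e :=
  BaseChange.mk _ P (exteriorPower.ιMulti A e v)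

theorem Sp.smul_mk {e : ℕ} (P Q : EnvAlg A L) (v : Fin e → L) :
    P • Sp.mk Q v = Sp.mk (A := A) (P * Q) v :=
  BaseChange.smul_mk _ _ _ _

/-- `P ⊗ (v₁ ∧ ⋯ ∧ v_e)` as an alternating map of `v`. -/
def Sp.mkAlt {e : ℕ} (P : EnvAlg A L) : L [⋀^Fin e]→ₗ[ℤ] Sp A L e where
  toFun v := Sp.mk P v
  map_update_add' v i x y := by
    unfold Sp.mk
    rw [← BaseChange.mk_add_right]
    congr 1
    convert (exteriorPower.ιMulti A e).map_update_add v i x y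
  map_update_smul' v i c x := by
    have h := (((exteriorPower.ιMulti A e (M := L)).toMultilinearMap.restrictScalars
      ℤ).map_update_smul v i c x)
    let f : ⋀[A]^e L →+ Sp A L e := AddMonoidHom.mk' (BaseChange.mk _ P)
      (fun a b => BaseChange.mk_add_right _ P a b)
    refine Eq.trans ?_ (map_zsmul f c _)
    change BaseChange.mk _ P _ = BaseChange.mk _ P _
    congr 1
  map_eq_zero_of_eq' v i j h hij := by
    unfold Sp.mk
    rw [(exteriorPower.ιMulti A e).map_eq_zero_of_eq v h hij]
    have := BaseChange.mk_add_right (polyToEnv A L).toRingHom P (0 : ⋀[A]^e L) 0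
    rwa [add_zero, left_eq_add] at this

@[simp] theorem Sp.mkAlt_apply {e : ℕ} (P : EnvAlg A L) (v : Fin e → L) :
    Sp.mkAlt P v = Sp.mk (A := A) P v := rfl

theorem Sp.mk_add_left {e : ℕ} (P Q : EnvAlg A L) (v : Fin e → L) :
    Sp.mk (P + Q) v = Sp.mk (A := A) P v + Sp.mk Q v :=
  BaseChange.mk_add_left _ _ _ _

theorem Sp.mk_cons_smul {e : ℕ} (P : EnvAlg A L) (a : A) (x : L) (v : Fin e → L) :
    Sp.mk P (Fin.cons (a • x) v : Fin (e + 1) → L)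
      = Sp.mk (A := A) (P * polyToEnv A L a) (Fin.cons x v : Fin (e + 1) → L) := by
  unfold Sp.mk
  rw [show (P * polyToEnv A L a) = P * (polyToEnv A L).toRingHom a from rfl, BaseChange.mk_mul]
  congr 1
  exact (exteriorPower.ιMulti A (e + 1)).map_vecCons_smul v a x

theorem Sp.mk_cons_cons_smul {e : ℕ} (P : EnvAlg A L) (a : A) (x y : L) (v : Fin e → L) :
    Sp.mk P (Fin.cons x (Fin.cons (a • y) v : Fin (e + 1) → L) : Fin (e + 2) → L)
      = Sp.mk (A := A) (P * polyToEnv A L a)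
          (Fin.cons x (Fin.cons y v : Fin (e + 1) → L) : Fin (e + 2) → L) := by
  unfold Sp.mk
  rw [show (P * polyToEnv A L a) = P * (polyToEnv A L).toRingHom a from rfl, BaseChange.mk_mul]
  congr 1
  exact ((exteriorPower.ιMulti A (e + 2)).curryLeft x).map_vecCons_smul v a y

/-- `∑ᵢ (-1)^{i-1} λᵢ ⊗ (λ₁ ∧ ⋯ λ̂ᵢ ⋯ ∧ λ_e)`. -/
def spencerFst (e : ℕ) : L [⋀^Fin (e + 1)]→ₗ[ℤ] Sp A L e :=
  AlternatingMap.alternatizeUncurryFin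
    (AddMonoidHom.toIntLinearMap
      { toFun := fun x => Sp.mkAlt (lieToEnv x)
        map_zero' := by
          ext v
          have := Sp.mk_add_left (A := A) (lieToEnv (0 : L)) (lieToEnv 0) v
          rwa [← lieToEnv_add, add_zero, left_eq_add] at this
        map_add' := fun x y => by
          ext v
          simp [lieToEnv_add, Sp.mk_add_left] })

theorem spencerFst_apply (e : ℕ) (v : Fin (e + 1) → L) :
    spencerFst (A := A) e v
      = ∑ i : Fin (e + 1), (-1 : ℤ) ^ (i : ℕ) • Sp.mk (lieToEnv (v i)) (i.removeNth v) :=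
  AlternatingMap.alternatizeUncurryFin_apply _ _

/-- `∑_{i<j} (-1)^{i+j} 1 ⊗ ([λᵢ, λⱼ] ∧ λ₁ ∧ ⋯ λ̂ᵢ ⋯ λ̂ⱼ ⋯ ∧ λ_e)`, as half of the
antisymmetrization over all pairs `(i, j)`. -/
def spencerSnd (e : ℕ) : L [⋀^Fin (e + 2)]→ₗ[ℤ] Sp A L (e + 1) :=
  algebraMap ℂ (EnvAlg A L) (-(1 / 2)) •
    AlternatingMap.alternatizeUncurryFin
      (AlternatingMap.alternatizeUncurryFinLM ∘ₗ
        (AddMonoidHom.toIntLinearMap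
          { toFun := fun x => (Sp.mkAlt (1 : EnvAlg A L)).curryLeft ∘ₗ
              (AddMonoidHom.mk' (fun y : L => ⁅x, y⁆) (lie_add x)).toIntLinearMap
            map_zero' := by
              ext y v
              simp
            map_add' := fun x y => by
              ext z v
              simp } : L →ₗ[ℤ] L →ₗ[ℤ] L [⋀^Fin e]→ₗ[ℤ] Sp A L (e + 1)))

theorem spencerSnd_apply (e : ℕ) (v : Fin (e + 2) → L) :
    spencerSnd (A := A) e v
      = ∑ i : Fin (e + 1), ∑ j ≥ i, (-1 : ℤ) ^ (i + (j + 1) : ℕ) •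
          Sp.mk (1 : EnvAlg A L) (Fin.cons ⁅v i.castSucc, v j.succ⁆ (j.removeNth (i.castSucc.removeNth v)) :
            Fin (e + 1) → L) := by
  unfold spencerSnd
  rw [AlternatingMap.smul_apply, AlternatingMap.alternatizeUncurryFin_alternatizeUncurryFinLM_comp_apply,
    Finset.smul_sum]
  refine Finset.sum_congr rfl fun i _ => ?_
  rw [Finset.smul_sum]
  refine Finset.sum_congr rfl fun j _ => ?_
  rw [smul_comm, ← add_assoc, pow_succ, mul_neg_one, neg_smul, ← smul_neg]
  congr 1
  set w := j.removeNth (i.castSucc.removeNth v)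
  change algebraMap ℂ (EnvAlg A L) (-(1 / 2)) •
    ((Sp.mkAlt (1 : EnvAlg A L)).curryLeft ⁅v i.castSucc, v j.succ⁆ w -
      (Sp.mkAlt (1 : EnvAlg A L)).curryLeft ⁅v j.succ, v i.castSucc⁆ w)
    = -((Sp.mkAlt (1 : EnvAlg A L)).curryLeft ⁅v i.castSucc, v j.succ⁆ w)
  generalize (Sp.mkAlt (e := e + 1) (1 : EnvAlg A L)).curryLeft = F
  have hF : F ⁅v j.succ, v i.castSucc⁆ w = -F ⁅v i.castSucc, v j.succ⁆ w := by
    rw [← lie_skew, map_neg]; rfl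
  have h2 : algebraMap ℂ (EnvAlg A L) (-(1 / 2)) * 2 = -1 := by
    rw [show (2 : EnvAlg A L) = algebraMap ℂ _ 2 from (map_ofNat (algebraMap ℂ _) 2).symm,
      ← map_mul]
    norm_num
  rw [hF, sub_neg_eq_add, ← two_smul (EnvAlg A L), smul_smul, h2, neg_one_smul]

/-- The sum of the two parts of the differential, as an alternating `ℤ`-multilinear map. -/
def spencerAlt : (e : ℕ) → L [⋀^Fin (e + 1)]→ₗ[ℤ] Sp A L e
  | 0 => spencerFst 0
  | e + 1 => spencerFst (e + 1) + spencerSnd e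

theorem removeNth_zero_cons {α : Type*} {e : ℕ} (x : α) (v : Fin e → α) :
    (0 : Fin (e + 1)).removeNth (Fin.cons x v : Fin (e + 1) → α) = v := by
  ext i; simp [Fin.removeNth_apply]

theorem removeNth_succ_cons {α : Type*} {e : ℕ} (x : α) (v : Fin (e + 1) → α) (i : Fin (e + 1)) :
    i.succ.removeNth (Fin.cons x v : Fin (e + 2) → α) = Fin.cons x (i.removeNth v) := by
  ext j
  refine Fin.cases ?_ (fun j => ?_) j <;> simp [Fin.removeNth_apply]

theorem removeNth_castSucc_succ_cons {α : Type*} {e : ℕ} (x : α) (v : Fin (e + 1) → α)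
    (i : Fin e) :
    i.succ.castSucc.removeNth (Fin.cons x v : Fin (e + 2) → α)
      = Fin.cons x (i.castSucc.removeNth v) :=
  removeNth_succ_cons x v i.castSucc

theorem Sp.mk_inner_smul (e : ℕ) (a : A) (x : L) (u : Fin (e + 1) → L) (i : Fin e)
    (j : Fin (e + 1)) (hij : i.succ ≤ j) :
    Sp.mk (1 : EnvAlg A L) (Fin.cons ⁅(Fin.cons (a • x) u : Fin (e + 2) → L) i.succ.castSucc,
          (Fin.cons (a • x) u : Fin (e + 2) → L) j.succ⁆
        (j.removeNth (i.succ.castSucc.removeNth (Fin.cons (a • x) u : Fin (e + 2) → L))) :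
          Fin (e + 1) → L)
      = polyToEnv A L a • Sp.mk (1 : EnvAlg A L) (Fin.cons ⁅(Fin.cons x u : Fin (e + 2) → L) i.succ.castSucc,
          (Fin.cons x u : Fin (e + 2) → L) j.succ⁆
        (j.removeNth (i.succ.castSucc.removeNth (Fin.cons x u : Fin (e + 2) → L))) :
          Fin (e + 1) → L) := by
  obtain ⟨j, rfl⟩ := Fin.exists_succ_eq.mpr
    (show j ≠ 0 from fun h => by rw [h] at hij; exact absurd hij (by simp))
  obtain ⟨e, rfl⟩ : ∃ m, e = m + 1 := ⟨e - 1, by have := i.pos; omega⟩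
  have h1 : ∀ y : L, (Fin.cons y u : Fin (e + 1 + 2) → L) i.succ.castSucc = u i.castSucc :=
    fun y => by rw [← Fin.succ_castSucc, Fin.cons_succ]
  simp only [h1, Fin.cons_succ, removeNth_castSucc_succ_cons, removeNth_succ_cons]
  rw [Sp.mk_cons_cons_smul, Sp.smul_mk, one_mul, mul_one]

theorem spencerAlt_cons_smul (e : ℕ) (a : A) (x : L) (u : Fin e → L) :
    spencerAlt (A := A) e (Fin.cons (a • x) u : Fin (e + 1) → L)
      = polyToEnv A L a • spencerAlt (A := A) e (Fin.cons x u : Fin (e + 1) → L) := by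
  rcases e with _ | e
  · simp only [spencerAlt, spencerFst_apply]
    simp [lieToEnv_smul, Sp.smul_mk]
  · have hIci : Finset.Ici (0 : Fin (e + 1)) = Finset.univ := by ext; simp
    have key : ∀ i : Fin (e + 1),
        (-1 : ℤ) ^ (i + 1 : ℕ) • Sp.mk (lieToEnv (u i))
            (Fin.cons (a • x) (i.removeNth u) : Fin (e + 1) → L)
          + (-1 : ℤ) ^ (i + 1 : ℕ) • Sp.mk (1 : EnvAlg A L)
            (Fin.cons ⁅a • x, u i⁆ (i.removeNth u) : Fin (e + 1) → L)
        = polyToEnv A L a • ((-1 : ℤ) ^ (i + 1 : ℕ) • Sp.mk (lieToEnv (u i))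
            (Fin.cons x (i.removeNth u) : Fin (e + 1) → L)
          + (-1 : ℤ) ^ (i + 1 : ℕ) • Sp.mk (1 : EnvAlg A L)
            (Fin.cons ⁅x, u i⁆ (i.removeNth u) : Fin (e + 1) → L)) := by
      intro i
      rw [← smul_add, ← smul_add, smul_comm (polyToEnv A L a)]
      congr 1
      have hb : ⁅a • x, u i⁆ = a • ⁅x, u i⁆ + (-⁅u i, a⁆) • x := by
        rw [← lie_skew, LieRinehartRing.leibniz_smul_right, ← lie_skew (u i) x]
        simp only [smul_neg, neg_smul]
        abel
      have hadd : ∀ y z : L, Sp.mk (1 : EnvAlg A L) (Fin.cons (y + z) (i.removeNth u) : Fin (e + 1) → L)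
          = Sp.mk (1 : EnvAlg A L) (Fin.cons y (i.removeNth u) : Fin (e + 1) → L)
            + Sp.mk (1 : EnvAlg A L) (Fin.cons z (i.removeNth u) : Fin (e + 1) → L) :=
        (Sp.mkAlt (1 : EnvAlg A L)).map_vecCons_add (i.removeNth u)
      have hP : lieToEnv (u i) * polyToEnv A L a + polyToEnv A L (-⁅u i, a⁆)
          = polyToEnv A L a * lieToEnv (u i) := by
        rw [map_neg, polyToEnv_lie]; abel
      rw [hb, hadd, Sp.mk_cons_smul, Sp.mk_cons_smul, Sp.mk_cons_smul, smul_add, Sp.smul_mk,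
        Sp.smul_mk, one_mul, one_mul, mul_one, add_left_comm, ← Sp.mk_add_left, hP]
      exact add_comm _ _
    have hexp : ∀ y : L, spencerAlt (A := A) (e + 1) (Fin.cons y u : Fin (e + 2) → L)
        = Sp.mk (lieToEnv y) u
          + ∑ i : Fin (e + 1), ((-1 : ℤ) ^ (i + 1 : ℕ) • Sp.mk (lieToEnv (u i))
              (Fin.cons y (i.removeNth u) : Fin (e + 1) → L)
            + (-1 : ℤ) ^ (i + 1 : ℕ) • Sp.mk (1 : EnvAlg A L)
              (Fin.cons ⁅y, u i⁆ (i.removeNth u) : Fin (e + 1) → L))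
          + ∑ i : Fin e, ∑ j ≥ i.succ, (-1 : ℤ) ^ (i.succ + (j + 1) : ℕ) •
            Sp.mk (1 : EnvAlg A L)
              (Fin.cons ⁅(Fin.cons y u : Fin (e + 2) → L) i.succ.castSucc,
                (Fin.cons y u : Fin (e + 2) → L) j.succ⁆
              (j.removeNth (i.succ.castSucc.removeNth (Fin.cons y u : Fin (e + 2) → L))) :
                Fin (e + 1) → L) := by
      intro y
      simp only [spencerAlt, AlternatingMap.add_apply, spencerFst_apply, spencerSnd_apply]
      rw [Fin.sum_univ_succ (n := e + 1), Finset.sum_add_distrib]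
      conv_lhs => arg 2; rw [Fin.sum_univ_succ, hIci]
      simp only [Fin.val_zero, pow_zero, one_smul, Fin.cons_zero, Fin.cons_succ, Fin.val_succ,
        removeNth_zero_cons, removeNth_succ_cons, Fin.castSucc_zero, zero_add]
      abel
    rw [hexp, hexp, smul_add, smul_add, Finset.smul_sum, Finset.smul_sum]
    congr 1
    · congr 1
      · rw [lieToEnv_smul, Sp.smul_mk]
      · exact Finset.sum_congr rfl fun i _ => key i
    · refine Finset.sum_congr rfl fun i _ => ?_
      rw [Finset.smul_sum]
      refine Finset.sum_congr rfl fun j hj => ?_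
      rw [Sp.mk_inner_smul e a x u i j (Finset.mem_Ici.mp hj), smul_comm (polyToEnv A L a)]

theorem spencerAlt_update_smul (e : ℕ) (v : Fin (e + 1) → L) (i : Fin (e + 1)) (a : A) (x : L) :
    spencerAlt (A := A) e (Function.update v i (a • x))
      = polyToEnv A L a • spencerAlt (A := A) e (Function.update v i x) := by
  have h : ∀ y : L, spencerAlt (A := A) e (Function.update v i y)
      = Equiv.Perm.sign (Equiv.swap i 0) • spencerAlt (A := A) e
        (Fin.cons y (Fin.tail (v ∘ Equiv.swap i 0)) : Fin (e + 1) → L) := by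
    intro y
    have h1 := (spencerAlt (A := A) e).map_perm
      (Function.update v i y ∘ Equiv.swap i 0) (Equiv.swap i 0)
    rw [Function.comp_assoc, ← Equiv.Perm.coe_mul, Equiv.swap_mul_self, Equiv.Perm.coe_one,
      Function.comp_id, Function.update_comp_equiv, Equiv.symm_swap, Equiv.swap_apply_left] at h1
    rw [h1]
    congr 2
    conv_lhs => rw [← Fin.cons_self_tail (v ∘ Equiv.swap i 0), Fin.update_cons_zero]
  rw [h, h, spencerAlt_cons_smul, smul_comm]

/-- `Sp_L^{-e}` as an `A`-module. -/
abbrev Sp.polyModule (A L : Type*) [CommRing A] [Algebra ℂ A] [LieRing L] [LieAlgebra ℂ L]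
    [Module A L] [LieRingModule L A] [LieRinehartRing A L] [LieRinehartAlgebra ℂ A L] (e : ℕ) :
    Module A (Sp A L e) :=
  Module.compHom _ (polyToEnv A L).toRingHom

theorem Sp.polyModule_smul {e : ℕ} (a : A) (y : Sp A L e) :
    (letI := Sp.polyModule A L e; a • y) = polyToEnv A L a • y := by
  rfl

attribute [local instance] Sp.polyModule

/-- `spencerAlt` as an alternating `A`-multilinear map. -/
def spencerAltA (e : ℕ) : L [⋀^Fin (e + 1)]→ₗ[A] Sp A L e where
  toFun := spencerAlt (A := A) e
  map_update_add' v i x y := by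
    convert (spencerAlt (A := A) e).map_update_add v i x y
  map_update_smul' v i a x := by
    rw [Sp.polyModule_smul]
    convert spencerAlt_update_smul (A := A) e v i a x
  map_eq_zero_of_eq' := (spencerAlt (A := A) e).map_eq_zero_of_eq'

/-- The differential `d^{-(e+1)} : Sp_L^{-(e+1)} → Sp_L^{-e}`; it is given by the formula of
`spencerD_zero_mk` and `spencerD_succ_mk`. -/
def spencerD (A L : Type*) [CommRing A] [Algebra ℂ A] [LieRing L] [LieAlgebra ℂ L] [Module A L]
    [LieRingModule L A] [LieRinehartRing A L] [LieRinehartAlgebra ℂ A L] (e : ℕ) :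
    Sp A L (e + 1) →ₗ[EnvAlg A L] Sp A L e :=
  BaseChange.lift
    { toFun := exteriorPower.alternatingMapLinearEquiv (spencerAltA e)
      map_add' := map_add _
      map_smul' := fun a x =>
        (map_smul (exteriorPower.alternatingMapLinearEquiv (spencerAltA e)) a x).trans
          (Sp.polyModule_smul a _) }

theorem spencerD_mk_eq (e : ℕ) (P : EnvAlg A L) (v : Fin (e + 1) → L) :
    spencerD A L e (Sp.mk P v) = P • spencerAlt (A := A) e v := by
  unfold spencerD Sp.mk
  refine (BaseChange.lift_mk _ _ _).trans ?_
  congr 1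
  exact exteriorPower.alternatingMapLinearEquiv_apply_ιMulti _ v

/-- `d^{-1}(P ⊗ λ) = Pλ`. -/
theorem spencerD_zero_mk (P : EnvAlg A L) (v : Fin 1 → L) :
    spencerD A L 0 (Sp.mk P v) = Sp.mk (P * lieToEnv (v 0)) ![] := by
  rw [spencerD_mk_eq, spencerAlt, spencerFst_apply, Fin.sum_univ_succ]
  simp only [Fin.val_zero, pow_zero, one_smul, Finset.univ_eq_empty, Finset.sum_empty, add_zero,
    Sp.smul_mk]
  congr 1
  exact Subsingleton.elim _ _

/-- The formula for the differential.  The pairs `i < j` of indices in `Fin (e + 2)` are written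
`(i.castSucc, j.succ)` with `i ≤ j` in `Fin (e + 1)`; indices start from `0`, which does not change
the sign `(-1)^{i+j}` and turns `(-1)^{i-1}` into `(-1)^i`. -/
theorem spencerD_succ_mk (e : ℕ) (P : EnvAlg A L) (v : Fin (e + 2) → L) :
    spencerD A L (e + 1) (Sp.mk P v)
      = ∑ i : Fin (e + 2), (-1 : ℤ) ^ (i : ℕ) • Sp.mk (P * lieToEnv (v i)) (i.removeNth v)
        + ∑ i : Fin (e + 1), ∑ j ≥ i, (-1 : ℤ) ^ ((i.castSucc : ℕ) + (j.succ : ℕ)) •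
          Sp.mk P (Fin.cons ⁅v i.castSucc, v j.succ⁆ (j.removeNth (i.castSucc.removeNth v)) :
            Fin (e + 1) → L) := by
  rw [spencerD_mk_eq, spencerAlt, AlternatingMap.add_apply, spencerFst_apply, spencerSnd_apply,
    smul_add, Finset.smul_sum, Finset.smul_sum]
  congr 1
  · exact Finset.sum_congr rfl fun i _ => by rw [smul_comm, Sp.smul_mk]
  · refine Finset.sum_congr rfl fun i _ => ?_
    rw [Finset.smul_sum]
    exact Finset.sum_congr rfl fun j _ => by
      rw [smul_comm, Sp.smul_mk, mul_one, Fin.val_castSucc, Fin.val_succ]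

end LieRinehart
/-! ### The Spencer complex over `R` -/

/-- The homomorphism `U(L) → R` given by the inclusion `L ⊆ F₁R`. -/
def envToDiffOp (L : LieRinehartSubalgebra (PolyRing n) (F1 n p)) :
    EnvAlg (PolyRing n) L →ₐ[ℂ] DiffOp n p :=
  EnvAlg.lift (ofPoly n p) (fun x => ((x : F1 n p) : DiffOp n p))
    (fun _ _ => rfl) (fun _ _ => rfl) (fun _ _ => rfl) (fun x a => F1.ofPoly_lie (x : F1 n p) a)

/-- The left `R`-module `Sp_{R,r}^{-e} = R ⊗_{U(L)} Sp_L^{-e}`. -/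
abbrev SpR (L : LieRinehartSubalgebra (PolyRing n) (F1 n p)) (e : ℕ) : Type :=
  BaseChange (envToDiffOp L).toRingHom (Sp (PolyRing n) L e)

/-- The differential `Sp_{R,r}^{-(e+1)} → Sp_{R,r}^{-e}`, the base change of that of `Sp_L`. -/
def spencerRD (L : LieRinehartSubalgebra (PolyRing n) (F1 n p)) (e : ℕ) :
    SpR L (e + 1) →ₗ[DiffOp n p] SpR L e :=
  BaseChange.map (envToDiffOp L).toRingHom (spencerD (PolyRing n) L e)

/-- The canonical map `Sp_L^0 = U(L) ⊗_A Λ^0 L → U(L)`. -/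
def spZeroToEnv (A L : Type*) [CommRing A] [Algebra ℂ A] [LieRing L] [LieAlgebra ℂ L] [Module A L]
    [LieRingModule L A] [LieRinehartRing A L] [LieRinehartAlgebra ℂ A L] :
    Sp A L 0 →ₗ[EnvAlg A L] EnvAlg A L :=
  BaseChange.lift
    ((polyToEnv A L).toRingHom.toSemilinearMap.comp
      (exteriorPower.zeroEquiv A L).toLinearMap)

theorem spZeroToEnv_mk (A L : Type*) [CommRing A] [Algebra ℂ A] [LieRing L] [LieAlgebra ℂ L]
    [Module A L] [LieRingModule L A] [LieRinehartRing A L] [LieRinehartAlgebra ℂ A L]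
    (P : EnvAlg A L) (v : Fin 0 → L) : spZeroToEnv A L (Sp.mk P v) = P := by
  unfold spZeroToEnv Sp.mk
  refine (BaseChange.lift_mk _ _ _).trans ?_
  change P * polyToEnv A L (exteriorPower.zeroEquiv A L (exteriorPower.ιMulti A 0 v)) = P
  rw [exteriorPower.zeroEquiv_ιMulti, map_one, mul_one]

/-- The canonical map `Sp_{R,r}^0 = R ⊗_{U(L)} Sp_L^0 → R`. -/
def spRZeroToDiffOp (L : LieRinehartSubalgebra (PolyRing n) (F1 n p)) :
    SpR L 0 →ₗ[DiffOp n p] DiffOp n p :=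
  BaseChange.lift ((envToDiffOp L).toRingHom.toSemilinearMap.comp (spZeroToEnv (PolyRing n) L))

theorem spRZeroToDiffOp_mk (L : LieRinehartSubalgebra (PolyRing n) (F1 n p)) (P : DiffOp n p)
    (Q : EnvAlg (PolyRing n) L) (v : Fin 0 → L) :
    spRZeroToDiffOp L (BaseChange.mk _ P (Sp.mk Q v)) = P * envToDiffOp L Q := by
  unfold spRZeroToDiffOp
  refine (BaseChange.lift_mk _ _ _).trans ?_
  change P * envToDiffOp L (spZeroToEnv (PolyRing n) L (Sp.mk Q v)) = _
  rw [spZeroToEnv_mk]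

/-- The augmentation `Sp_{R,r}^0 → R / I`, `P ⊗ (Q ⊗ a) ↦ PQa`. -/
def spencerAug (L : LieRinehartSubalgebra (PolyRing n) (F1 n p))
    (I : Submodule (DiffOp n p) (DiffOp n p)) : SpR L 0 →ₗ[DiffOp n p] DiffOp n p ⧸ I :=
  I.mkQ ∘ₗ spRZeroToDiffOp L

end

end SpencerResolution

/-! Give `P ⊗ r_I`, with `r_I` the wedge product of the `rᵢ`, `i ∈ I`, the weight `ord P + ∑_{i ∈ I}
oᵢ`. The part of the Spencer differential that omits one factor sends it to the sum of `± P rᵢ ⊗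
r_{I∖i}`. On total symbols, right multiplication by `rᵢ` is multiplication by `σ(rᵢ)` up to lower
degree, so modulo lower weight this part is the Koszul differential of the symbols. The part with
brackets lowers the weight. If `oᵢ = oⱼ = 1`, the bracket is a combination of generators of order at
most `1 < 2`. If one of the two orders is `0`, the bracket is a commutator with a polynomial, hence
of order `0`, and independence of the symbols leaves only the generator of order `0` in it. This is
recorded in `IsAdapted` and proved in `exists_isAdapted_basis`; the comparison of differentials is
`IsAdapted.symbolCoord_spencerRD`.

The Koszul complex of a weakly regular sequence is exact in nonzero degrees (`koszulD_exact`). Hence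
if the differential of `z` has smaller weight than `z` would lead one to expect, the top part of `z`
is a Koszul cycle, thus a Koszul boundary, and subtracting a Spencer boundary lowers the weight of
`z` (`IsAdapted.exists_sub_mem`). The weights are natural numbers, so iteration terminates
(`IsAdapted.exists_spencerRD_eq`). Taken down to zero, this is exactness. Stopped at weight `k`, it
writes any `P ∈ I` of order at most `k` as the differential of a chain of weight at most `k`; its
symbol is then a Koszul image, hence in the ideal of the `σ(rᵢ)`, which is involutivity.

That the Spencer differential squares to zero is derived from Cartan calculus: Lie derivatives are
defined by the homotopy formula and shown to commute with the differential, by induction on the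
exterior degree. -/

namespace SpencerResolution

/-! ### The Koszul complex of a weakly regular sequence -/

section Koszul

variable {S : Type*} [CommRing S] {m : ℕ}

/-- The sign of `i` in `insert i J`. -/
def koszulSign (i : Fin m) (J : Finset (Fin m)) : ℤ := (-1) ^ (J.filter (· < i)).card

/-- The differential of the total Koszul complex of `f`, in coordinates. -/
def koszulD (f : Fin m → S) : (Finset (Fin m) → S) →ₗ[S] (Finset (Fin m) → S) where
  toFun z J := ∑ i, if i ∈ J then 0 else koszulSign i J • (f i * z (insert i J))
  map_add' z w := by
    ext J
    simp only [Pi.add_apply, ← Finset.sum_add_distrib]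
    refine Finset.sum_congr rfl fun i _ => ?_
    split_ifs <;> simp [mul_add]
  map_smul' c z := by
    ext J
    simp only [Pi.smul_apply, RingHom.id_apply, smul_eq_mul, Finset.mul_sum]
    refine Finset.sum_congr rfl fun i _ => ?_
    split_ifs
    · simp
    · rw [mul_smul_comm]; congr 1; ring

theorem koszulD_apply (f : Fin m → S) (z : Finset (Fin m) → S) (J : Finset (Fin m)) :
    koszulD f z J = ∑ i, if i ∈ J then 0 else koszulSign i J • (f i * z (insert i J)) := rfl

/-- `z` involves only the first `t` of the generators. -/
def SupportedBelow (t : ℕ) (z : Finset (Fin m) → S) : Prop :=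
  ∀ I, z I ≠ 0 → ∀ i ∈ I, (i : ℕ) < t

/-- The product with the generator of index `τ`, without sign. -/
def adjoinIndex (τ : Fin m) (v : Finset (Fin m) → S) (I : Finset (Fin m)) : S :=
  if τ ∈ I then v (I.erase τ) else 0

/-- All indices in the support of `v` are smaller than `τ`, so `τ` acts as a last exterior factor:
it does not affect the signs of the other removals, and removing it costs `(-1)^|J|`. -/
theorem koszulD_adjoinIndex (f : Fin m → S) (τ : Fin m) (v : Finset (Fin m) → S)
    (hv : SupportedBelow τ v) :
    koszulD f (adjoinIndex τ v) = adjoinIndex τ (koszulD f v) + fun J => (-1) ^ J.card * (f τ * v J) := by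
  ext J
  rw [Pi.add_apply]
  by_cases hτ : τ ∈ J
  · have h0 : v J = 0 := by
      by_contra h
      exact lt_irrefl _ (hv J h τ hτ)
    rw [h0, mul_zero, mul_zero, add_zero, koszulD_apply, adjoinIndex, if_pos hτ, koszulD_apply]
    refine Finset.sum_congr rfl fun i _ => ?_
    by_cases hi : i ∈ J
    · rw [if_pos hi]
      by_cases hiτ : i = τ
      · subst hiτ
        rw [if_neg (by simp), Finset.insert_erase hτ, h0, mul_zero, smul_zero]
      · rw [if_pos (Finset.mem_erase.mpr ⟨hiτ, hi⟩)]
    · have hiτ : i ≠ τ := fun h => hi (h ▸ hτ)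
      rw [if_neg hi, if_neg (fun h => hi (Finset.mem_of_mem_erase h)), adjoinIndex,
        if_pos (Finset.mem_insert_of_mem hτ), Finset.erase_insert_of_ne hiτ]
      by_cases h : v (insert i (J.erase τ)) = 0
      · rw [h, mul_zero, smul_zero, smul_zero]
      -- A nonzero value forces `i < τ`, so `τ` is not counted in the sign of `i`.
      · have hlt := hv _ h i (Finset.mem_insert_self _ _)
        congr 1
        unfold koszulSign
        congr 2
        ext j
        simp only [Finset.mem_filter, Finset.mem_erase]
        constructor
        · rintro ⟨h1, h2⟩
          refine ⟨⟨?_, h1⟩, h2⟩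
          rintro rfl
          exact absurd (Fin.lt_def.mp h2) (by omega)
        · rintro ⟨⟨_, h1⟩, h2⟩
          exact ⟨h1, h2⟩
  · rw [koszulD_apply, adjoinIndex, if_neg hτ, zero_add, Finset.sum_eq_single τ]
    · rw [if_neg hτ, adjoinIndex, if_pos (Finset.mem_insert_self _ _), Finset.erase_insert hτ]
      by_cases h : v J = 0
      · simp [h]
      · have : J.filter (· < τ) = J :=
          Finset.filter_true_of_mem fun j hj => Fin.lt_def.mpr (hv J h j hj)
        rw [koszulSign, this]
        simp
    · intro i _ hi
      split_ifs
      · rfl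
      · rw [adjoinIndex, if_neg, mul_zero, smul_zero]
        simp [Ne.symm hi, hτ]
    · simp

theorem SupportedBelow.koszulD {f : Fin m → S} {t : ℕ} {v : Finset (Fin m) → S}
    (hv : SupportedBelow t v) : SupportedBelow t (koszulD f v) := by
  intro J hJ i hi
  rw [koszulD_apply] at hJ
  obtain ⟨j, _, hj⟩ := Finset.exists_ne_zero_of_sum_ne_zero hJ
  split_ifs at hj
  · exact absurd rfl hj
  · refine hv (insert j J) (fun h => hj ?_) i (Finset.mem_insert_of_mem hi)
    rw [h, mul_zero, smul_zero]

theorem SupportedBelow.sub {t : ℕ} {v w : Finset (Fin m) → S}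
    (hv : SupportedBelow t v) (hw : SupportedBelow t w) : SupportedBelow t (v - w) := by
  intro I hI
  by_cases h : v I = 0
  · exact hw I (fun h' => hI (by simp [h, h']))
  · exact hv I h

theorem SupportedBelow.add {t : ℕ} {v w : Finset (Fin m) → S}
    (hv : SupportedBelow t v) (hw : SupportedBelow t w) : SupportedBelow t (v + w) := by
  intro I hI
  by_cases h : v I = 0
  · exact hw I (fun h' => hI (by simp [h, h']))
  · exact hv I h

theorem koszulD_single_empty (f : Fin m → S) (c : S) :
    koszulD f (Pi.single ∅ c) = 0 := by
  ext J
  rw [koszulD_apply]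
  refine Finset.sum_eq_zero fun i _ => ?_
  split_ifs
  · rfl
  · rw [Pi.single_eq_of_ne (Finset.insert_ne_empty _ _), mul_zero, smul_zero]

theorem koszulD_empty (f : Fin m → S) (z : Finset (Fin m) → S) :
    koszulD f z ∅ = ∑ i, f i * z {i} := by
  rw [koszulD_apply]
  exact Finset.sum_congr rfl fun i _ => by simp [koszulSign]

/-- The Koszul complex of a weakly regular sequence is exact in nonzero degrees. -/
theorem koszulD_exact_below (f : Fin m → S)
    (hf : ∀ (i : Fin m) (c : S), f i * c ∈ Ideal.span (f '' {j | j < i}) →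
      c ∈ Ideal.span (f '' {j | j < i})) :
    ∀ t ≤ m, ∀ z : Finset (Fin m) → S, SupportedBelow t z → koszulD f z = 0 → z ∅ = 0 →
      ∃ w, SupportedBelow t w ∧ w ∅ = 0 ∧ koszulD f w = z := by
  intro t
  induction t with
  | zero =>
    intro _ z hz _ h0
    refine ⟨0, fun I h => absurd rfl h, rfl, ?_⟩
    rw [map_zero]
    ext I
    by_contra h
    have hI : I = ∅ := Finset.eq_empty_of_forall_notMem fun i hi => by
      have := hz I (Ne.symm h) i hi
      omega
    exact h (by rw [hI, h0]; rfl)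
  | succ t ih =>
    intro ht z hz hDz h0
    classical
    set τ : Fin m := ⟨t, ht⟩ with hτ
    -- Write `z = u + v ∧ e_τ` with `u` and `v` free of the last generator `e_τ`.
    set u : Finset (Fin m) → S := fun I => if τ ∈ I then 0 else z I with hu
    set v : Finset (Fin m) → S := fun I => if τ ∈ I then 0 else z (insert τ I) with hv
    have hlt : ∀ i : Fin m, (i : ℕ) < t + 1 → i ≠ τ → (i : ℕ) < t := by
      intro i h1 h2
      have : (i : ℕ) ≠ t := fun h => h2 (Fin.ext h)
      omega
    have hub : SupportedBelow t u := by
      intro I hI i hi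
      simp only [hu] at hI
      split_ifs at hI with h
      · exact absurd rfl hI
      · exact hlt i (hz I hI i hi) (fun h' => h (h' ▸ hi))
    have hvb : SupportedBelow t v := by
      intro I hI i hi
      simp only [hv] at hI
      split_ifs at hI with h
      · exact absurd rfl hI
      · exact hlt i (hz _ hI i (Finset.mem_insert_of_mem hi)) (fun h' => h (h' ▸ hi))
    have hzuv : z = u + adjoinIndex τ v := by
      ext I
      rw [Pi.add_apply, adjoinIndex]
      by_cases h : τ ∈ I
      · simp [hu, hv, h, Finset.insert_erase]
      · simp [hu, h]
    have hD := hDz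
    rw [hzuv, map_add, koszulD_adjoinIndex f τ v hvb] at hD
    -- The coordinates of `Dz = 0` that contain `τ` see only `Dv`; those that do not give `Du = ∓
    -- f_τ v`.
    have hDv : koszulD f v = 0 := by
      ext J
      by_cases h : τ ∈ J
      · by_contra h'
        exact lt_irrefl _ (hvb.koszulD J h' τ h)
      · have h1 := congrFun hD (insert τ J)
        have h2 : koszulD f u (insert τ J) = 0 := by
          by_contra h'
          exact lt_irrefl _ (hub.koszulD _ h' τ (Finset.mem_insert_self _ _))
        have h3 : v (insert τ J) = 0 := by simp [hv]
        simpa [h2, h3, adjoinIndex, Finset.erase_insert h] using h1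
    have hDu : ∀ J, koszulD f u J + (-1) ^ J.card * (f τ * v J) = 0 := by
      intro J
      by_cases h : τ ∈ J
      · have h2 : koszulD f u J = 0 := by
          by_contra h'
          exact lt_irrefl _ (hub.koszulD _ h' τ h)
        simp [h2, hv, h]
      · have h1 := congrFun hD J
        simpa [hDv, adjoinIndex, h] using h1
    -- The induction hypothesis needs a cycle vanishing at `∅`, but `v ∅` may be nonzero. Here
    -- regularity enters: `f_τ · v ∅` lies in the ideal of the earlier `f_j`, hence so does `v ∅`,
    -- and the constant `v ∅` is a boundary by itself.
    obtain ⟨w₁, hw₁b, hw₁0, hw₁⟩ : ∃ w, SupportedBelow t w ∧ w ∅ = 0 ∧ koszulD f w = v := by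
      have hc : v ∅ ∈ Ideal.span (f '' {j | j < τ}) := by
        apply hf τ
        have h1 := hDu ∅
        rw [Finset.card_empty, pow_zero, one_mul] at h1
        rw [eq_neg_of_add_eq_zero_right h1, koszulD_empty]
        refine neg_mem (sum_mem fun i _ => ?_)
        by_cases h : u {i} = 0
        · rw [h, mul_zero]; exact zero_mem _
        · exact Ideal.mul_mem_right _ _ (Ideal.subset_span
            ⟨i, Fin.lt_def.mpr (hub _ h i (Finset.mem_singleton_self i)), rfl⟩)
      obtain ⟨w', hw'b, hw'0, hw'⟩ := ih (by omega) (v - Pi.single ∅ (v ∅))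
        (hvb.sub (by
          intro I hI i hi
          by_cases h : I = ∅
          · subst h; simp at hi
          · exact absurd (Pi.single_eq_of_ne h _) hI))
        (by rw [map_sub, hDv, koszulD_single_empty, sub_zero]) (by simp)
      have key : ∀ c ∈ Ideal.span (f '' {j | j < τ}), ∃ w : Finset (Fin m) → S,
          SupportedBelow t w ∧ w ∅ = 0 ∧ koszulD f w = Pi.single ∅ c := by
        intro c hc
        induction hc using Submodule.span_induction with
        | mem c hc =>
          obtain ⟨j, hj, rfl⟩ := hc
          refine ⟨Pi.single {j} 1, ?_, by simp, ?_⟩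
          · intro I hI i hi
            by_cases h : I = {j}
            · subst h
              rw [Finset.mem_singleton.mp hi]
              exact Fin.lt_def.mp hj
            · exact absurd (Pi.single_eq_of_ne h _) hI
          · ext J
            by_cases hJ : J = ∅
            · subst hJ
              rw [koszulD_empty, Pi.single_eq_same, Finset.sum_eq_single j]
              · simp
              · intro i _ hi
                rw [Pi.single_eq_of_ne (by simpa using hi), mul_zero]
              · simp
            · rw [koszulD_apply, Pi.single_eq_of_ne hJ]
              refine Finset.sum_eq_zero fun i _ => ?_
              split_ifs with h
              · rfl
              · rw [Pi.single_eq_of_ne, mul_zero, smul_zero]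
                intro h'
                have h1 := congrArg Finset.card h'
                rw [Finset.card_insert_of_notMem h, Finset.card_singleton] at h1
                exact hJ (Finset.card_eq_zero.mp (by omega))
        | zero => exact ⟨0, fun I h => absurd rfl h, rfl, by simp⟩
        | add a b _ _ ha hb =>
          obtain ⟨wa, h1, h2, h3⟩ := ha
          obtain ⟨wb, h4, h5, h6⟩ := hb
          exact ⟨wa + wb, h1.add h4, by simp [h2, h5], by rw [map_add, h3, h6, Pi.single_add]⟩
        | smul a c _ hc =>
          obtain ⟨w, h1, h2, h3⟩ := hc
          refine ⟨a • w, fun I hI => h1 I fun h => hI (by simp [h]), by simp [h2], ?_⟩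
          rw [map_smul, h3, ← Pi.single_smul]
      obtain ⟨w'', hw''b, hw''0, hw''⟩ := key _ hc
      exact ⟨w' + w'', hw'b.add hw''b, by simp [hw'0, hw''0], by rw [map_add, hw', hw'']; simp⟩
    -- The boundary of `w₁ ∧ e_τ` is `v ∧ e_τ + g`; subtracting it from `z` leaves `u - g`, which is
    -- free of `e_τ`.
    set g : Finset (Fin m) → S := fun J => (-1) ^ J.card * (f τ * w₁ J) with hg
    have hgb : SupportedBelow t g := fun I hI => hw₁b I fun h => hI (by simp [hg, h])
    have hz' : u - g = z - koszulD f (adjoinIndex τ w₁) := by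
      rw [koszulD_adjoinIndex f τ w₁ hw₁b, hw₁, hzuv]; abel
    -- Checked directly from the formula for `Du`, without using that `D` squares to zero: adding an
    -- index to `J` flips `(-1)^|J|`.
    have hDD : koszulD f (u - g) = 0 := by
      rw [map_sub, sub_eq_zero]
      ext J
      rw [eq_neg_of_add_eq_zero_left (hDu J), ← hw₁, koszulD_apply, koszulD_apply,
        Finset.mul_sum, Finset.mul_sum, ← Finset.sum_neg_distrib]
      refine Finset.sum_congr rfl fun i _ => ?_
      split_ifs with h
      · simp
      · simp only [hg, Finset.card_insert_of_notMem h, zsmul_eq_mul]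
        ring
    -- That `u - g` vanishes at `∅` uses `w₁ ∅ = 0`; this is why the primitives are required to
    -- vanish there.
    obtain ⟨w₂, hw₂b, hw₂0, hw₂⟩ := ih (by omega) (u - g) (hub.sub hgb) hDD
      (by simp [hu, hg, h0, hw₁0])
    refine ⟨w₂ + adjoinIndex τ w₁, ?_, by simp [adjoinIndex, hw₂0], by rw [map_add, hw₂, hz']; simp⟩
    refine SupportedBelow.add (fun I hI i hi => (hw₂b I hI i hi).trans (Nat.lt_succ_self t)) ?_
    intro I hI i hi
    rw [adjoinIndex] at hI
    split_ifs at hI with h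
    · by_cases hiτ : i = τ
      · rw [hiτ]; exact Nat.lt_succ_self t
      · exact (hw₁b _ hI i (Finset.mem_erase.mpr ⟨hiτ, hi⟩)).trans (Nat.lt_succ_self t)
    · exact absurd rfl hI

theorem koszulD_exact (f : Fin m → S)
    (hf : RingTheory.Sequence.IsWeaklyRegular S (List.ofFn f)) (z : Finset (Fin m) → S)
    (hz : koszulD f z = 0) (h0 : z ∅ = 0) : ∃ w, koszulD f w = z := by
  obtain ⟨w, _, _, hw⟩ := koszulD_exact_below f (fun i c hc => by
    rw [RingTheory.Sequence.isWeaklyRegular_iff_Fin] at hf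
    have hi := hf ⟨i, by simp⟩
    -- With the ideal of the list prefix rewritten this way, injectivity on the quotient becomes the
    -- divisibility condition of `koszulD_exact_below`.
    have hspan : Ideal.ofList ((List.ofFn f).take i) • (⊤ : Submodule S S)
        = Ideal.span (f '' {j | j < i}) := by
      rw [smul_eq_mul, Ideal.mul_top, Ideal.ofList]
      congr 1
      ext x
      simp only [Set.mem_ofPred_eq, List.mem_take_iff_getElem, List.getElem_ofFn, Set.mem_image]
      constructor
      · rintro ⟨j, hj, rfl⟩
        exact ⟨⟨j, by simp at hj; omega⟩, Fin.lt_def.mpr (by simp at hj ⊢; omega), rfl⟩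
      · rintro ⟨j, hj, rfl⟩
        exact ⟨j, by simpa using Fin.lt_def.mp hj, rfl⟩
    have h2 : (Submodule.Quotient.mk c : S ⧸ (Ideal.ofList ((List.ofFn f).take i) •
        (⊤ : Submodule S S))) = 0 := by
      apply hi
      simp only [smul_zero]
      rw [← Submodule.Quotient.mk_smul, Submodule.Quotient.mk_eq_zero, hspan]
      simpa using hc
    rwa [Submodule.Quotient.mk_eq_zero, hspan] at h2) m le_rfl z (fun I _ i _ => i.2) hz h0
  exact ⟨w, hw⟩

theorem koszulD_single (f : Fin m → S) (I : Finset (Fin m)) (q : S) :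
    koszulD f (Pi.single I q)
      = ∑ i ∈ I, koszulSign i (I.erase i) • Pi.single (I.erase i) (f i * q) := by
  ext J
  rw [koszulD_apply, Finset.sum_apply, ← Finset.sum_filter_add_sum_filter_not Finset.univ (· ∈ I),
    Finset.filter_mem_eq_inter, Finset.univ_inter, add_eq_left.mpr]
  · refine Finset.sum_congr rfl fun i hi => ?_
    rw [Pi.smul_apply]
    by_cases hJ : J = I.erase i
    · subst hJ
      rw [if_neg (Finset.notMem_erase i I), Finset.insert_erase hi, Pi.single_eq_same,
        Pi.single_eq_same]
    · rw [Pi.single_eq_of_ne hJ, smul_zero]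
      split_ifs with h
      · rfl
      · rw [Pi.single_eq_of_ne, mul_zero, smul_zero]
        rintro rfl
        exact hJ (Finset.erase_insert h).symm
  · refine Finset.sum_eq_zero fun i hi => ?_
    split_ifs with h
    · rfl
    · rw [Pi.single_eq_of_ne, mul_zero, smul_zero]
      rintro rfl
      simp at hi

end Koszul

noncomputable section
open scoped TensorProduct

/-! ### The differential of the Spencer complex squares to zero -/

section Cartan

/-- The inductive step in the computation of the commutator of two Lie derivatives. -/
theorem commutator_comp_eq {U M N : Type*} [Ring U] [AddCommGroup M] [AddCommGroup N] [Module U M]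
    [Module U N] {X Y Z : M →ₗ[U] M} {X' Y' Z' : N →ₗ[U] N} {E Ex Ey E₁ E₂ E₃ : M →ₗ[U] N}
    (hX : X' ∘ₗ E = E ∘ₗ X - Ex) (hY : Y' ∘ₗ E = E ∘ₗ Y - Ey) (hZ : Z' ∘ₗ E = E ∘ₗ Z - E₃)
    (hXy : X' ∘ₗ Ey = Ey ∘ₗ X - E₁) (hYx : Y' ∘ₗ Ex = Ex ∘ₗ Y - E₂) (hE : E₁ = E₃ + E₂)
    (h : X ∘ₗ Y - Y ∘ₗ X = -Z) : (X' ∘ₗ Y' - Y' ∘ₗ X') ∘ₗ E = (-Z') ∘ₗ E := by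
  subst hE
  ext u
  have h1 : ∀ v, X' (E v) = E (X v) - Ex v := LinearMap.congr_fun hX
  have h2 : ∀ v, Y' (E v) = E (Y v) - Ey v := LinearMap.congr_fun hY
  have h3 : ∀ v, Z' (E v) = E (Z v) - E₃ v := LinearMap.congr_fun hZ
  have h4 : ∀ v, X' (Ey v) = Ey (X v) - (E₃ v + E₂ v) := LinearMap.congr_fun hXy
  have h5 : ∀ v, Y' (Ex v) = Ex (Y v) - E₂ v := LinearMap.congr_fun hYx
  have h6 : X (Y u) - Y (X u) = -Z u := LinearMap.congr_fun h u
  have h7 : E (X (Y u)) - E (Y (X u)) = -E (Z u) := by rw [← map_sub, h6, map_neg]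
  rw [sub_eq_iff_eq_add] at h7
  simp only [LinearMap.comp_apply, LinearMap.sub_apply, LinearMap.neg_apply, h1, h2, h3, h4, h5,
    map_sub, h7]
  abel

/-- The inductive step in the proof that Lie derivatives commute with the differential. -/
theorem differential_comp_eq {U M₀ M₁ M₂ : Type*} [Ring U] [AddCommGroup M₀] [AddCommGroup M₁]
    [AddCommGroup M₂] [Module U M₀] [Module U M₁] [Module U M₂] {d₀ : M₁ →ₗ[U] M₀}
    {d₁ : M₂ →ₗ[U] M₁} {X₀ : M₀ →ₗ[U] M₀} {X₁ Y₁ Z₁ : M₁ →ₗ[U] M₁} {X₂ : M₂ →ₗ[U] M₂}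
    {Ey Exy : M₁ →ₗ[U] M₂} {Ey' Exy' : M₀ →ₗ[U] M₁} (hX : X₂ ∘ₗ Ey = Ey ∘ₗ X₁ - Exy)
    (hX' : X₁ ∘ₗ Ey' = Ey' ∘ₗ X₀ - Exy') (hy : Y₁ = d₁ ∘ₗ Ey + Ey' ∘ₗ d₀)
    (hxy : Z₁ = d₁ ∘ₗ Exy + Exy' ∘ₗ d₀) (hd : d₀ ∘ₗ X₁ = X₀ ∘ₗ d₀)
    (hc : X₁ ∘ₗ Y₁ - Y₁ ∘ₗ X₁ = -Z₁) : (d₁ ∘ₗ X₂) ∘ₗ Ey = (X₁ ∘ₗ d₁) ∘ₗ Ey := by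
  subst hy hxy
  ext u
  have h1 : ∀ v, X₂ (Ey v) = Ey (X₁ v) - Exy v := LinearMap.congr_fun hX
  have h2 : ∀ v, X₁ (Ey' v) = Ey' (X₀ v) - Exy' v := LinearMap.congr_fun hX'
  have h3 : ∀ v, d₀ (X₁ v) = X₀ (d₀ v) := LinearMap.congr_fun hd
  have h4 := LinearMap.congr_fun hc u
  simp only [LinearMap.comp_apply, LinearMap.sub_apply, LinearMap.neg_apply, LinearMap.add_apply,
    map_add, h2, h3] at h4
  simp only [LinearMap.comp_apply, h1, map_sub]
  rw [← sub_eq_zero] at h4 ⊢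
  rw [← neg_eq_zero, ← h4]
  abel



variable {A L : Type*} [CommRing A] [Algebra ℂ A] [LieRing L] [LieAlgebra ℂ L] [Module A L]
  [LieRingModule L A] [LieRinehartRing A L] [LieRinehartAlgebra ℂ A L]

/-- Decomposable wedges span the exterior power over `A`, and coefficients in `A` can be moved
across the tensor into `U(L)`. -/
theorem Sp.hom_ext {N : Type*} [AddCommGroup N] [Module (EnvAlg A L) N] {e : ℕ}
    {f g : Sp A L e →ₗ[EnvAlg A L] N} (h : ∀ v, f (Sp.mk 1 v) = g (Sp.mk 1 v)) : f = g := by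
  refine BaseChange.hom_ext fun ω => ?_
  have hω : ω ∈ Submodule.span A (Set.range (exteriorPower.ιMulti A e (M := L))) := by
    rw [exteriorPower.ιMulti_span]; trivial
  induction hω using Submodule.span_induction with
  | mem ω hω => obtain ⟨v, rfl⟩ := hω; exact h v
  | zero =>
    have h0 : BaseChange.mk (polyToEnv A L).toRingHom (1 : EnvAlg A L) (0 : ⋀[A]^e L) = 0 := by
      have := BaseChange.mk_add_right (polyToEnv A L).toRingHom 1 (0 : ⋀[A]^e L) 0
      rwa [add_zero, left_eq_add] at this
    rw [h0, map_zero, map_zero]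
  | add ω η _ _ hω hη => rw [BaseChange.mk_add_right, map_add, map_add, hω, hη]
  | smul a ω _ hω =>
    rw [← BaseChange.mk_mul, one_mul, ← mul_one ((polyToEnv A L).toRingHom a),
      ← BaseChange.smul_mk, map_smul, map_smul, hω]

/-- The exterior product with `x` from the left, `P ⊗ ω ↦ P ⊗ (x ∧ ω)`. -/
def Sp.wedge (x : L) (e : ℕ) : Sp A L e →ₗ[EnvAlg A L] Sp A L (e + 1) :=
  BaseChange.map _
    (exteriorPower.alternatingMapLinearEquiv ((exteriorPower.ιMulti A (e + 1)).curryLeft x))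

theorem Sp.wedge_mk (x : L) {e : ℕ} (P : EnvAlg A L) (v : Fin e → L) :
    Sp.wedge x e (Sp.mk P v) = Sp.mk P (Fin.cons x v : Fin (e + 1) → L) := by
  unfold Sp.wedge Sp.mk
  rw [BaseChange.map_mk, exteriorPower.alternatingMapLinearEquiv_apply_ιMulti]
  rfl

/-- This extensionality principle drives the inductions on exterior degree below: an identity in
degree `e + 1` is tested after wedging with one vector. -/
theorem Sp.hom_ext_wedge {N : Type*} [AddCommGroup N] [Module (EnvAlg A L) N] {e : ℕ}
    {f g : Sp A L (e + 1) →ₗ[EnvAlg A L] N} (h : ∀ x, f ∘ₗ Sp.wedge x e = g ∘ₗ Sp.wedge x e) :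
    f = g := by
  refine Sp.hom_ext fun v => ?_
  have := LinearMap.congr_fun (h (v 0)) (Sp.mk 1 (Fin.tail v))
  rwa [LinearMap.comp_apply, LinearMap.comp_apply, Sp.wedge_mk, Fin.cons_self_tail] at this

theorem Sp.wedge_add (x y : L) (e : ℕ) :
    Sp.wedge (A := A) (x + y) e = Sp.wedge x e + Sp.wedge y e := by
  refine Sp.hom_ext fun v => ?_
  rw [LinearMap.add_apply, Sp.wedge_mk, Sp.wedge_mk, Sp.wedge_mk]
  exact (Sp.mkAlt (1 : EnvAlg A L)).map_vecCons_add v x y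

/-- The Lie derivative along `x`, defined by Cartan's formula. -/
def Sp.lieDeriv (x : L) : (e : ℕ) → Sp A L e →ₗ[EnvAlg A L] Sp A L e
  | 0 => spencerD A L 0 ∘ₗ Sp.wedge x 0
  | e + 1 => spencerD A L (e + 1) ∘ₗ Sp.wedge x (e + 1) + Sp.wedge x e ∘ₗ spencerD A L e

theorem Sp.mk_cons_removeNth (P : EnvAlg A L) {e : ℕ} (v : Fin (e + 1) → L) (i : Fin (e + 1))
    (y : L) : Sp.mk P (Fin.cons y (i.removeNth v) : Fin (e + 1) → L)
      = (-1 : ℤ) ^ (i : ℕ) • Sp.mk (A := A) P (Function.update v i y) := by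
  have h := (Sp.mkAlt (A := A) (e := e + 1) P).map_insertNth i y (i.removeNth v)
  rw [Fin.insertNth_removeNth] at h
  have h2 : Sp.mk P (Function.update v i y)
      = (-1 : ℤ) ^ (i : ℕ) • Sp.mk (A := A) P (Fin.cons y (i.removeNth v) : Fin (e + 1) → L) := h
  rw [h2, smul_smul, ← mul_pow]
  simp

theorem Sp.mk_cons_cons_swap (P : EnvAlg A L) {e : ℕ} (v : Fin e → L) (x y : L) :
    Sp.mk P (Fin.cons x (Fin.cons y v : Fin (e + 1) → L) : Fin (e + 2) → L)
      = - Sp.mk (A := A) P (Fin.cons y (Fin.cons x v : Fin (e + 1) → L) : Fin (e + 2) → L) := by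
  have h := (Sp.mkAlt (A := A) (e := e + 2) P).map_swap
    (Fin.cons y (Fin.cons x v : Fin (e + 1) → L) : Fin (e + 2) → L) (i := 0) (j := 1) (by simp)
  rw [Sp.mkAlt_apply, Sp.mkAlt_apply] at h
  rw [← h]
  congr 1
  ext j
  refine Fin.cases ?_ (fun j => Fin.cases ?_ (fun j => ?_) j) j
  · simp
  · simp
  · rw [Function.comp_apply, Equiv.swap_apply_of_ne_of_ne (by simp)
      (Fin.succ_succ_ne_one j)]
    simp

/-- Sort the terms of the differential of `y ∧ u` by the role of `y`: it is the omitted factor, it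
enters a bracket `[y, uᵢ]`, or it is untouched. The untouched terms make up `-y ∧ du`, so the first
two kinds are the Lie derivative of `u` along `y`. -/
theorem spencerAlt_cons (e : ℕ) (y : L) (u : Fin (e + 1) → L) :
    spencerAlt (A := A) (e + 1) (Fin.cons y u : Fin (e + 2) → L)
      = Sp.mk (lieToEnv y) u
        - ∑ i : Fin (e + 1), Sp.mk (1 : EnvAlg A L) (Function.update u i ⁅y, u i⁆)
        - Sp.wedge y e (spencerAlt (A := A) e u) := by
  have hIci : Finset.Ici (0 : Fin (e + 1)) = Finset.univ := by ext; simp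
  have hfst : spencerFst (A := A) (e + 1) (Fin.cons y u : Fin (e + 2) → L)
      = Sp.mk (lieToEnv y) u - Sp.wedge y e (spencerFst (A := A) e u) := by
    rw [spencerFst_apply, Fin.sum_univ_succ, spencerFst_apply, map_sum, sub_eq_add_neg,
      ← Finset.sum_neg_distrib]
    congr 1
    · simp
    · refine Finset.sum_congr rfl fun i _ => ?_
      rw [map_zsmul, Sp.wedge_mk, removeNth_succ_cons, Fin.cons_succ, Fin.val_succ, pow_succ,
        mul_neg_one, neg_smul]
  have hbr : ∑ j ≥ (0 : Fin (e + 1)), (-1 : ℤ) ^ ((0 : Fin (e + 1)) + (j + 1) : ℕ) •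
      Sp.mk (1 : EnvAlg A L) (Fin.cons ⁅(Fin.cons y u : Fin (e + 2) → L) (Fin.castSucc 0),
          (Fin.cons y u : Fin (e + 2) → L) j.succ⁆
        (j.removeNth ((Fin.castSucc 0).removeNth (Fin.cons y u : Fin (e + 2) → L))) :
          Fin (e + 1) → L)
      = - ∑ i : Fin (e + 1), Sp.mk (1 : EnvAlg A L) (Function.update u i ⁅y, u i⁆) := by
    rw [hIci, ← Finset.sum_neg_distrib]
    refine Finset.sum_congr rfl fun i _ => ?_
    rw [Fin.castSucc_zero, removeNth_zero_cons, Fin.cons_zero, Fin.cons_succ,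
      Sp.mk_cons_removeNth, smul_smul, ← pow_add, Fin.val_zero, zero_add, add_right_comm,
      pow_succ, ← two_mul, pow_mul]
    simp
  cases e with
  | zero =>
    simp only [spencerAlt, AlternatingMap.add_apply]
    rw [hfst, spencerSnd_apply, Fin.sum_univ_succ, hbr]
    simp only [Finset.univ_eq_empty, Finset.sum_empty, add_zero]
    abel
  | succ e =>
    simp only [spencerAlt, AlternatingMap.add_apply, map_add]
    rw [hfst, spencerSnd_apply, Fin.sum_univ_succ, hbr]
    have hsnd : ∑ i : Fin (e + 1), ∑ j ≥ i.succ, (-1 : ℤ) ^ (i.succ + (j + 1) : ℕ) •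
        Sp.mk (1 : EnvAlg A L) (Fin.cons ⁅(Fin.cons y u : Fin (e + 3) → L) i.succ.castSucc,
            (Fin.cons y u : Fin (e + 3) → L) j.succ⁆
          (j.removeNth (i.succ.castSucc.removeNth (Fin.cons y u : Fin (e + 3) → L))) :
            Fin (e + 2) → L)
        = - Sp.wedge y (e + 1) (spencerSnd (A := A) e u) := by
      rw [spencerSnd_apply, map_sum, ← Finset.sum_neg_distrib]
      refine Finset.sum_congr rfl fun i _ => ?_
      rw [map_sum, ← Finset.sum_neg_distrib]
      have hIci' : Finset.Ici i.succ = (Finset.Ici i).map (Fin.succEmb (e + 1)) := by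
        rw [Fin.map_succEmb_Ici]
      rw [hIci', Finset.sum_map]
      refine Finset.sum_congr rfl fun j _ => ?_
      -- Both indices shift by one, so their sign is unchanged; the minus sign comes from
      -- interchanging `y` and the bracket.
      rw [Fin.coe_succEmb, map_zsmul, Sp.wedge_mk, removeNth_castSucc_succ_cons,
        removeNth_succ_cons, Fin.cons_succ, ← Fin.succ_castSucc, Fin.cons_succ,
        Sp.mk_cons_cons_swap, Fin.val_succ, Fin.val_succ, smul_neg]
      congr 2
      rw [show (i + 1 + (j + 1 + 1) : ℕ) = i + (j + 1) + 2 by ring, pow_add _ _ 2]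
      simp
    rw [hsnd]
    abel

/-- The two contributions of `x ∧ du` in Cartan's formula cancel. What remains acts slot by slot, so
commutation with wedge products can be checked term by term. -/
theorem Sp.lieDeriv_mk (x : L) (e : ℕ) (u : Fin e → L) :
    Sp.lieDeriv x e (Sp.mk (1 : EnvAlg A L) u) = Sp.mk (lieToEnv x) u
      - ∑ i : Fin e, Sp.mk (1 : EnvAlg A L) (Function.update u i ⁅x, u i⁆) := by
  cases e with
  | zero =>
    rw [Sp.lieDeriv, LinearMap.comp_apply, Sp.wedge_mk, spencerD_zero_mk]
    simp only [one_mul, Fin.cons_zero, Finset.univ_eq_empty, Finset.sum_empty, sub_zero]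
    congr 1
    exact Subsingleton.elim _ _
  | succ e =>
    rw [Sp.lieDeriv, LinearMap.add_apply, LinearMap.comp_apply, LinearMap.comp_apply, Sp.wedge_mk,
      spencerD_mk_eq, spencerD_mk_eq, one_smul, one_smul, spencerAlt_cons, sub_add_cancel]

theorem Sp.lieDeriv_wedge (x y : L) (e : ℕ) :
    Sp.lieDeriv (A := A) x (e + 1) ∘ₗ Sp.wedge y e
      = Sp.wedge y e ∘ₗ Sp.lieDeriv x e - Sp.wedge ⁅x, y⁆ e := by
  refine Sp.hom_ext fun u => ?_
  simp only [LinearMap.comp_apply, LinearMap.sub_apply, Sp.wedge_mk, Sp.lieDeriv_mk, map_sub,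
    map_sum, Fin.sum_univ_succ, Fin.cons_zero, Fin.cons_succ, Fin.update_cons_zero,
    ← Fin.cons_update]
  abel

/-- The minus sign is already visible in degree `0`, where the Lie derivative is right
multiplication by `x` and so reverses products. In the inductive step the brackets with the extra
factor match by the Jacobi identity. -/
theorem Sp.lieDeriv_commutator (x y : L) (e : ℕ) :
    Sp.lieDeriv (A := A) x e ∘ₗ Sp.lieDeriv y e - Sp.lieDeriv y e ∘ₗ Sp.lieDeriv x e
      = - Sp.lieDeriv ⁅x, y⁆ e := by
  induction e with
  | zero =>
    refine Sp.hom_ext fun u => ?_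
    have h : ∀ z (P : EnvAlg A L), Sp.lieDeriv z 0 (Sp.mk P u) = Sp.mk (P * lieToEnv z) u := by
      intro z P
      rw [← mul_one P, ← Sp.smul_mk, map_smul, Sp.lieDeriv_mk, mul_one]
      simp [Sp.smul_mk]
    simp only [LinearMap.comp_apply, LinearMap.sub_apply, LinearMap.neg_apply, h, one_mul]
    rw [sub_eq_iff_eq_add, eq_neg_add_iff_add_eq, ← Sp.mk_add_left, lieToEnv_lie, sub_add_cancel]
  | succ e ih =>
    refine Sp.hom_ext_wedge fun z => ?_
    exact commutator_comp_eq (Sp.lieDeriv_wedge x z e) (Sp.lieDeriv_wedge y z e)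
      (Sp.lieDeriv_wedge ⁅x, y⁆ z e) (Sp.lieDeriv_wedge x ⁅y, z⁆ e) (Sp.lieDeriv_wedge y ⁅x, z⁆ e)
      (by rw [← Sp.wedge_add, ← leibniz_lie]) ih

/-- Usually a consequence of `d² = 0`; here it is proved first, from the commutators of Lie
derivatives. In degree `0` the composite of `d` with the wedge by `y` is itself a Lie derivative, so
the claim is the commutator relation. -/
theorem spencerD_comp_lieDeriv (x : L) (e : ℕ) :
    spencerD A L e ∘ₗ Sp.lieDeriv x (e + 1) = Sp.lieDeriv x e ∘ₗ spencerD A L e := by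
  induction e generalizing x with
  | zero =>
    refine Sp.hom_ext_wedge fun y => ?_
    have h := Sp.lieDeriv_commutator (A := A) x y 0
    rw [LinearMap.comp_assoc, Sp.lieDeriv_wedge, LinearMap.comp_sub, ← LinearMap.comp_assoc]
    change Sp.lieDeriv y 0 ∘ₗ Sp.lieDeriv x 0 - Sp.lieDeriv ⁅x, y⁆ 0
      = Sp.lieDeriv x 0 ∘ₗ Sp.lieDeriv y 0
    rw [sub_eq_add_neg, ← h, add_sub_cancel]
  | succ e ih =>
    refine Sp.hom_ext_wedge fun y => ?_
    exact differential_comp_eq (Sp.lieDeriv_wedge x y (e + 1)) (Sp.lieDeriv_wedge x y e) rfl rfl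
      (ih x) (Sp.lieDeriv_commutator x y (e + 1))

/-- Expanding both sides of `dℒ = ℒd` by Cartan's formula leaves `d²(x ∧ u) = x ∧ d²u`, with right
side absent in the lowest degree; hence induction. -/
theorem spencerD_comp_spencerD (e : ℕ) : spencerD A L e ∘ₗ spencerD A L (e + 1) = 0 := by
  induction e with
  | zero =>
    refine Sp.hom_ext_wedge fun x => ?_
    have h := spencerD_comp_lieDeriv (A := A) x 0
    rw [LinearMap.zero_comp, LinearMap.comp_assoc]
    change spencerD A L 0 ∘ₗ (_ + _) = (_ ∘ₗ _) ∘ₗ _ at h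
    rwa [LinearMap.comp_add, LinearMap.comp_assoc, add_eq_right] at h
  | succ e ih =>
    refine Sp.hom_ext_wedge fun x => ?_
    have h := spencerD_comp_lieDeriv (A := A) x (e + 1)
    rw [LinearMap.zero_comp, LinearMap.comp_assoc]
    change spencerD A L (e + 1) ∘ₗ (_ + _) = (_ ∘ₗ _ + _ ∘ₗ _) ∘ₗ _ at h
    rwa [LinearMap.comp_add, LinearMap.add_comp, LinearMap.comp_assoc, LinearMap.comp_assoc, ih,
      LinearMap.comp_zero, add_zero, add_eq_right] at h

end Cartan

end

noncomputable section

/-! ### Leading symbols of products of operators -/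

variable {n p : ℕ}

/-- The elements of `Gr R` all of whose monomials have degree less than `k`. -/
def degLT (n p k : ℕ) : Submodule (PolyRing n) (GrRing n p) where
  carrier := {q | ∀ α : Fin n ⊕ Fin p →₀ ℕ, k ≤ α.degree → coeff α q = 0}
  add_mem' ha hb α hα := by rw [coeff_add, ha α hα, hb α hα, add_zero]
  zero_mem' α _ := coeff_zero α
  smul_mem' c q hq α hα := by rw [coeff_smul, hq α hα, smul_zero]

theorem degLT_mono {k l : ℕ} (h : k ≤ l) : degLT n p k ≤ degLT n p l :=
  fun _ hq α hα => hq α (h.trans hα)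

theorem monomial_mem_degLT {k : ℕ} {α : Fin n ⊕ Fin p →₀ ℕ} (h : α.degree < k) (a : PolyRing n) :
    monomial α a ∈ degLT n p k := by
  classical
  intro β hβ
  rw [coeff_monomial, if_neg]
  rintro rfl
  omega

theorem mul_mem_degLT {f q : GrRing n p} {o k : ℕ} (hf : f.IsHomogeneous o)
    (hq : q ∈ degLT n p k) : f * q ∈ degLT n p (k + o) := by
  classical
  intro α hα
  rw [coeff_mul]
  refine Finset.sum_eq_zero fun x hx => ?_
  rw [Finset.HasAntidiagonal.mem_antidiagonal] at hx
  by_cases h : x.1.degree = o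
  · rw [hq x.2, mul_zero]
    rw [← hx, map_add] at hα
    omega
  · rw [hf.coeff_eq_zero h, zero_mul]

@[simp] theorem totalSymbol_quantize (q : GrRing n p) :
    totalSymbol n p (quantize n p q) = q :=
  (LinearEquiv.ofBijective (quantize n p) ⟨quantize_injective, quantize_surjective⟩).symm_apply_apply
    q

theorem quantize_totalSymbol (P : DiffOp n p) : quantize n p (totalSymbol n p P) = P :=
  (LinearEquiv.ofBijective (quantize n p) ⟨quantize_injective, quantize_surjective⟩).apply_symm_apply
    P

theorem totalSymbol_mul_gen (P : DiffOp n p) (v : Fin n ⊕ Fin p) :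
    totalSymbol n p (P * gen v) = totalSymbol n p P * X v := by
  rw [← totalSymbol_quantize (totalSymbol n p P * X v), quantize_mul_X, quantize_totalSymbol]

theorem totalSymbol_opMonomial (α : Fin n ⊕ Fin p →₀ ℕ) :
    totalSymbol n p (opMonomial α) = monomial α 1 := by
  rw [← totalSymbol_quantize (monomial α 1), quantize_monomial, one_smul]

theorem totalSymbol_ofPoly_mul (c : PolyRing n) (P : DiffOp n p) :
    totalSymbol n p (ofPoly n p c * P) = c • totalSymbol n p P :=
  map_smul (totalSymbol n p) c P

/-- Peel off one generator `v` next to `c` and use `v c = c v + c'`. Right multiplication by `v` is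
exactly multiplication by a variable on total symbols, and the term with `c'` has one generator
fewer. -/
theorem totalSymbol_opMonomial_mul_ofPoly (α : Fin n ⊕ Fin p →₀ ℕ) (c : PolyRing n) :
    totalSymbol n p (opMonomial α * ofPoly n p c) - monomial α c ∈ degLT n p α.degree := by
  generalize hN : α.degree = N
  induction N generalizing α c with
  | zero =>
    have h0 : α = 0 := (Finsupp.degree_eq_zero_iff α).mp hN
    have : totalSymbol n p (ofPoly n p c) = monomial 0 c := by
      rw [← quantize_C, totalSymbol_quantize, C_apply]
    rw [h0, opMonomial_zero, one_mul, this, sub_self]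
    exact zero_mem _
  | succ N ih =>
    obtain ⟨v, hv⟩ : ∃ v, α v ≠ 0 := by
      by_contra! h
      have : α = 0 := Finsupp.ext h
      rw [this] at hN
      simp at hN
    have hle : Finsupp.single v 1 ≤ α := by
      rw [Finsupp.single_le_iff]; omega
    obtain ⟨β, rfl⟩ := exists_add_of_le hle
    rw [map_add, Finsupp.degree_single] at hN
    have hβ : β.degree = N := by omega
    obtain ⟨c', hc'⟩ : ∃ c', gen v * ofPoly n p c = ofPoly n p c * gen v + ofPoly n p c' := by
      rcases v with i | j
      · exact ⟨_, gen_inl_mul_ofPoly i c⟩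
      · exact ⟨0, by rw [(gen_inr_commute j _).eq, map_zero, add_zero]⟩
    have h1 := ih β c hβ
    have h2 := ih β c' hβ
    have h3 : totalSymbol n p (opMonomial (Finsupp.single v 1 + β) * ofPoly n p c)
        - monomial (Finsupp.single v 1 + β) c
        = X v * (totalSymbol n p (opMonomial β * ofPoly n p c) - monomial β c)
          + (totalSymbol n p (opMonomial β * ofPoly n p c') - monomial β c')
          + monomial β c' := by
      rw [add_comm, opMonomial_add, opMonomial_single, mul_assoc, hc', mul_add, ← mul_assoc,
        map_add, totalSymbol_mul_gen, ← mul_one c, ← monomial_mul, ← X, mul_one]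
      ring
    rw [h3]
    refine add_mem (add_mem (mul_mem_degLT (isHomogeneous_X _ v) h1) ?_) ?_
    · exact degLT_mono (Nat.le_succ N) h2
    · exact monomial_mem_degLT (by omega) c'

theorem totalSymbol_mul_ofPoly {k : ℕ} {P : DiffOp n p} (hP : totalSymbol n p P ∈ degLT n p (k + 1))
    (c : PolyRing n) :
    totalSymbol n p (P * ofPoly n p c) - c • totalSymbol n p P ∈ degLT n p k := by
  obtain ⟨q, rfl⟩ : ∃ q, quantize n p q = P := ⟨_, quantize_totalSymbol P⟩
  rw [totalSymbol_quantize] at hP ⊢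
  have hq : quantize n p q = ∑ α ∈ q.support, coeff α q • opMonomial α := by
    conv_lhs => rw [q.as_sum, map_sum]
    exact Finset.sum_congr rfl fun α _ => quantize_monomial α _
  have hq' : c • q = ∑ α ∈ q.support, coeff α q • monomial α c := by
    conv_lhs => rw [q.as_sum, Finset.smul_sum]
    exact Finset.sum_congr rfl fun α _ => by
      rw [smul_monomial, smul_monomial, smul_eq_mul, smul_eq_mul, mul_comm]
  rw [hq, hq', Finset.sum_mul, map_sum, ← Finset.sum_sub_distrib]
  refine sum_mem fun α hα => ?_
  rw [poly_smul_def, mul_assoc, totalSymbol_ofPoly_mul, ← smul_sub]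
  refine Submodule.smul_mem _ _ (degLT_mono ?_ (totalSymbol_opMonomial_mul_ofPoly α c))
  by_contra! h
  exact mem_support_iff.mp hα (hP α h)

theorem totalSymbol_mul_ofPoly_mem {k : ℕ} {P : DiffOp n p} (hP : totalSymbol n p P ∈ degLT n p k)
    (c : PolyRing n) : totalSymbol n p (P * ofPoly n p c) ∈ degLT n p k := by
  have h1 : totalSymbol n p (P * ofPoly n p c) - c • totalSymbol n p P ∈ degLT n p k :=
    totalSymbol_mul_ofPoly (degLT_mono (Nat.le_succ k) hP) c
  simpa using add_mem h1 (Submodule.smul_mem _ c hP)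

theorem totalSymbol_mem_degLT {k : ℕ} {P : DiffOp n p} (hP : P ∈ orderFiltration n p k) :
    totalSymbol n p P ∈ degLT n p (k + 1) := by
  unfold orderFiltration at hP
  induction hP using Submodule.span_induction with
  | mem P hP =>
    obtain ⟨α, hα, rfl⟩ := hP
    rw [totalSymbol_opMonomial]
    exact monomial_mem_degLT (Nat.lt_succ_of_le hα) 1
  | zero => rw [map_zero]; exact zero_mem _
  | add P Q _ _ hP hQ => rw [map_add]; exact add_mem hP hQ
  | smul a P _ hP => rw [map_smul]; exact Submodule.smul_mem _ _ hP

theorem symbol_isHomogeneous (k : ℕ) (P : DiffOp n p) : (symbol k P).IsHomogeneous k :=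
  homogeneousComponent_isHomogeneous _ _

/-- Multiplicativity of leading symbols, in the only case needed: the right factor has order at most
one, so it is a combination of `1` and the generators, and only its polynomial coefficients have to
be moved past `P`. -/
theorem totalSymbol_mul_sub_mem {o : ℕ} (ho : o ≤ 1) {r : DiffOp n p}
    (hr : r ∈ orderFiltration n p o) {k : ℕ} {P : DiffOp n p}
    (hP : totalSymbol n p P ∈ degLT n p (k + 1)) :
    totalSymbol n p (P * r) - symbol o r * totalSymbol n p P ∈ degLT n p (k + o) := by
  unfold orderFiltration at hr
  induction hr using Submodule.span_induction generalizing P with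
  | mem r hr =>
    obtain ⟨α, hα, rfl⟩ := hr
    have hα' : α.degree ≤ o := hα
    rcases eq_zero_or_single_of_degree_le α (hα'.trans ho) with rfl | ⟨v, rfl⟩
    · rw [symbol, totalSymbol_opMonomial, opMonomial_zero, mul_one]
      interval_cases o
      · rw [homogeneousComponent_of_mem (isHomogeneous_monomial 1 (map_zero _)), if_pos rfl,
          ← C_apply, C_1, one_mul, sub_self]
        exact zero_mem _
      -- Here `1` is considered with order `1`: its symbol vanishes, and `P` itself already lies
      -- below degree `k + 1`.
      · rw [homogeneousComponent_of_mem (isHomogeneous_monomial 1 (map_zero _)),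
          if_neg (by norm_num), zero_mul, sub_zero]
        exact hP
    · rw [Finsupp.degree_single] at hα'
      obtain rfl : o = 1 := le_antisymm ho hα'
      rw [symbol, totalSymbol_opMonomial, opMonomial_single, totalSymbol_mul_gen,
        homogeneousComponent_of_mem (isHomogeneous_monomial 1 (Finsupp.degree_single _ _)),
        if_pos rfl, ← X, mul_comm, sub_self]
      exact zero_mem _
  | zero =>
    rw [mul_zero, symbol, map_zero, map_zero, zero_mul, sub_zero]
    exact zero_mem _
  | add r s _ _ hr hs =>
    have h : totalSymbol n p (P * (r + s)) - symbol o (r + s) * totalSymbol n p P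
        = (totalSymbol n p (P * r) - symbol o r * totalSymbol n p P)
          + (totalSymbol n p (P * s) - symbol o s * totalSymbol n p P) := by
      rw [mul_add, map_add, symbol, map_add, map_add, symbol, symbol]; ring
    rw [h]
    exact add_mem (hr hP) (hs hP)
  -- Since `P (c r) = (P c) r`, the induction hypothesis is applied to `P c` instead of `P`, which
  -- is why `P` is generalized.
  | smul c r _ hr =>
    have h1 := totalSymbol_mul_ofPoly hP c
    have h2 := hr (totalSymbol_mul_ofPoly_mem hP c)
    have h : totalSymbol n p (P * c • r) - symbol o (c • r) * totalSymbol n p P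
        = (totalSymbol n p (P * ofPoly n p c * r)
            - symbol o r * totalSymbol n p (P * ofPoly n p c))
          + symbol o r * (totalSymbol n p (P * ofPoly n p c) - c • totalSymbol n p P) := by
      rw [poly_smul_def, mul_assoc, symbol, totalSymbol_ofPoly_mul, map_smul, ← symbol,
        mul_sub, smul_mul_assoc, mul_smul_comm]
      ring
    rw [h]
    exact add_mem h2 (mul_mem_degLT (symbol_isHomogeneous o r) h1)

end

noncomputable section

/-! ### Bases of modules obtained by extension of scalars -/

section BaseChangeBasis

variable {B S M ι : Type*} [Ring B] [Ring S] (φ : B →+* S) [AddCommGroup M] [Module B M]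

/-- The additive map `m ↦ s ⊗ m`. -/
def BaseChange.mkHom (s : S) : M →+ BaseChange φ M :=
  AddMonoidHom.mk' (BaseChange.mk φ s) (BaseChange.mk_add_right φ s)

@[simp] theorem BaseChange.mkHom_apply (s : S) (m : M) :
    BaseChange.mkHom φ s m = BaseChange.mk φ s m := rfl

/-- The coordinates on `S ⊗_B M` given by a basis of `M`. -/
def BaseChange.coordinates (b : Module.Basis ι B M) : BaseChange φ M →ₗ[S] (ι →₀ S) :=
  BaseChange.lift (φ := φ)
    { toFun := fun m => (b.repr m).mapRange φ (map_zero φ)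
      map_add' := fun m m' => by
        rw [map_add, Finsupp.mapRange_add (map_add φ)]
      map_smul' := fun c m => by
        ext i
        simp }

/-- The basis `1 ⊗ bᵢ` of `S ⊗_B M`. -/
def BaseChange.basis (b : Module.Basis ι B M) : Module.Basis ι S (BaseChange φ M) :=
  Module.Basis.ofRepr
    (LinearEquiv.ofLinearMap (BaseChange.coordinates φ b)
      (Finsupp.linearCombination S fun i => BaseChange.mk φ 1 (b i))
      (by
        ext i : 2
        simp only [LinearMap.comp_apply, Finsupp.lsingle_apply, Finsupp.linearCombination_single,
          one_smul, LinearMap.id_apply]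
        unfold BaseChange.coordinates
        rw [BaseChange.lift_mk, one_smul]
        change Finsupp.mapRange φ (map_zero φ) (b.repr (b i)) = _
        rw [b.repr_self, Finsupp.mapRange_single, map_one])
      (BaseChange.hom_ext fun m => by
        rw [LinearMap.comp_apply, LinearMap.id_apply]
        unfold BaseChange.coordinates
        rw [BaseChange.lift_mk, one_smul]
        change Finsupp.linearCombination S _ (Finsupp.mapRange φ (map_zero φ) (b.repr m)) = _
        rw [Finsupp.linearCombination_apply, Finsupp.sum_mapRange_index (by simp)]
        conv_rhs => rw [← b.linearCombination_repr m, Finsupp.linearCombination_apply,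
          ← BaseChange.mkHom_apply, map_finsuppSum]
        refine Finsupp.sum_congr fun i _ => ?_
        rw [BaseChange.mkHom_apply, ← BaseChange.mk_mul, one_mul, BaseChange.smul_mk, mul_one]))

@[simp] theorem BaseChange.basis_apply (b : Module.Basis ι B M) (i : ι) :
    BaseChange.basis φ b i = BaseChange.mk φ 1 (b i) := by
  unfold BaseChange.basis
  rw [Module.Basis.coe_ofRepr]
  change Finsupp.linearCombination S (fun i => BaseChange.mk φ 1 (b i)) (Finsupp.single i 1) = _
  simp

end BaseChangeBasis

/-! ### The grading of the Koszul complex over `Gr R` -/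

section Weight

variable {n p m : ℕ}

/-- The families whose `I`-th component has degree less than `k - ∑_{i ∈ I} o i`. -/
def weightLT (o : Fin m → ℕ) (n p k : ℕ) : AddSubgroup (Finset (Fin m) → GrRing n p) where
  carrier := {z | ∀ I (α : Fin n ⊕ Fin p →₀ ℕ), k ≤ α.degree + ∑ i ∈ I, o i → coeff α (z I) = 0}
  add_mem' hz hw I α h := by rw [Pi.add_apply, coeff_add, hz I α h, hw I α h, add_zero]
  zero_mem' _ _ _ := coeff_zero _
  neg_mem' hz I α h := by rw [Pi.neg_apply, coeff_neg, hz I α h, neg_zero]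

theorem weightLT_mono (o : Fin m → ℕ) {k l : ℕ} (h : k ≤ l) :
    weightLT o n p k ≤ weightLT o n p l :=
  fun _ hz I α hα => hz I α (h.trans hα)

theorem single_mem_weightLT {o : Fin m → ℕ} {k l : ℕ} {I : Finset (Fin m)} {q : GrRing n p}
    (hq : q ∈ degLT n p k) (hl : k + ∑ i ∈ I, o i ≤ l) :
    (Pi.single I q : Finset (Fin m) → GrRing n p) ∈ weightLT o n p l := by
  intro J α hα
  by_cases h : J = I
  · subst h
    rw [Pi.single_eq_same]
    exact hq α (by omega)
  · rw [Pi.single_eq_of_ne h, coeff_zero]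

theorem exists_mem_weightLT (o : Fin m → ℕ) (z : Finset (Fin m) → GrRing n p) :
    ∃ k, z ∈ weightLT o n p k := by
  -- The sum over all `I` serves as a common upper bound in place of a maximum.
  refine ⟨∑ I, ((z I).totalDegree + 1 + ∑ i ∈ I, o i), fun I α h => ?_⟩
  have h1 := Finset.single_le_sum (f := fun I => (z I).totalDegree + 1 + ∑ i ∈ I, o i)
    (fun _ _ => Nat.zero_le _) (Finset.mem_univ I)
  by_contra h2
  have h3 := le_totalDegree (mem_support_iff.mpr h2)
  have h4 : α.degree = α.sum fun _ e => e := rfl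
  omega

theorem weightLT_zero (o : Fin m → ℕ) {z : Finset (Fin m) → GrRing n p}
    (hz : z ∈ weightLT o n p 0) : z = 0 := by
  ext I α
  rw [hz I α (Nat.zero_le _)]
  simp

/-- The component of weight `k`. -/
def weightComponent (o : Fin m → ℕ) (k : ℕ) (z : Finset (Fin m) → GrRing n p) :
    Finset (Fin m) → GrRing n p :=
  fun I => if ∑ i ∈ I, o i ≤ k then homogeneousComponent (k - ∑ i ∈ I, o i) (z I) else 0

theorem coeff_weightComponent (o : Fin m → ℕ) (k : ℕ) (z : Finset (Fin m) → GrRing n p)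
    (I : Finset (Fin m)) (α : Fin n ⊕ Fin p →₀ ℕ) :
    coeff α (weightComponent o k z I) = if α.degree + ∑ i ∈ I, o i = k then coeff α (z I) else 0 := by
  unfold weightComponent
  split_ifs with h1 h2 h2
  · rw [coeff_homogeneousComponent, if_pos (by omega)]
  · rw [coeff_homogeneousComponent, if_neg (by omega)]
  · omega
  · rw [coeff_zero]

theorem weightComponent_mem (o : Fin m → ℕ) (k : ℕ) (z : Finset (Fin m) → GrRing n p) :
    weightComponent o k z ∈ weightLT o n p (k + 1) := by
  intro I α h
  rw [coeff_weightComponent, if_neg (by omega)]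

theorem weightComponent_eq_zero {o : Fin m → ℕ} {k : ℕ} {z : Finset (Fin m) → GrRing n p}
    (hz : z ∈ weightLT o n p k) : weightComponent o k z = 0 := by
  ext I α
  rw [coeff_weightComponent]
  split_ifs with h
  · rw [hz I α h.ge]; simp
  · simp

theorem sub_weightComponent_mem {o : Fin m → ℕ} {k : ℕ} {z : Finset (Fin m) → GrRing n p}
    (hz : z ∈ weightLT o n p (k + 1)) : z - weightComponent o k z ∈ weightLT o n p k := by
  intro I α h
  rw [Pi.sub_apply, coeff_sub, coeff_weightComponent]
  split_ifs with h'
  · rw [sub_self]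
  · rw [hz I α (by omega), sub_zero]

theorem coeff_zsmul (c : ℤ) (q : GrRing n p) (α : Fin n ⊕ Fin p →₀ ℕ) :
    coeff α (c • q) = c • coeff α q :=
  map_zsmul (coeffAddMonoidHom α) c q

/-- Multiplying by `f i` raises the degree by `o i`, and removing `i` from the index set lowers the
shift by the same amount. Hence Koszul primitives can be chosen homogeneous in weight. -/
theorem koszulD_weightComponent {o : Fin m → ℕ} {f : Fin m → GrRing n p}
    (hf : ∀ i, (f i).IsHomogeneous (o i)) (k : ℕ) (z : Finset (Fin m) → GrRing n p) :
    koszulD f (weightComponent o k z) = weightComponent o k (koszulD f z) := by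
  classical
  ext1 J
  ext1 α
  have key : ∀ i, i ∉ J → coeff α (f i * weightComponent o k z (insert i J))
      = if α.degree + ∑ i ∈ J, o i = k then coeff α (f i * z (insert i J)) else 0 := by
    intro i hi
    rw [coeff_mul, coeff_mul]
    have h1 : ∀ x ∈ Finset.HasAntidiagonal.antidiagonal α,
        coeff x.1 (f i) * coeff x.2 (weightComponent o k z (insert i J))
        = if α.degree + ∑ i ∈ J, o i = k then coeff x.1 (f i) * coeff x.2 (z (insert i J))
          else 0 := by
      intro x hx
      rw [Finset.HasAntidiagonal.mem_antidiagonal] at hx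
      by_cases h : x.1.degree = o i
      · have h2 : (x.2.degree + ∑ i ∈ insert i J, o i = k) ↔ (α.degree + ∑ i ∈ J, o i = k) := by
          rw [Finset.sum_insert hi, ← hx, map_add]
          omega
        rw [coeff_weightComponent]
        simp only [h2, mul_ite, mul_zero]
      · rw [(hf i).coeff_eq_zero h]
        simp
    rw [Finset.sum_congr rfl h1]
    split_ifs <;> simp
  have hterm : ∀ i, coeff α (if i ∈ J then 0
        else koszulSign i J • (f i * weightComponent o k z (insert i J)))
      = if α.degree + ∑ i ∈ J, o i = k then
          coeff α (if i ∈ J then 0 else koszulSign i J • (f i * z (insert i J))) else 0 := by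
    intro i
    by_cases hi : i ∈ J
    · simp [hi]
    · rw [if_neg hi, if_neg hi, coeff_zsmul, coeff_zsmul, key i hi]
      split_ifs <;> simp
  rw [coeff_weightComponent, koszulD_apply, koszulD_apply, coeff_sum, coeff_sum,
    Finset.sum_congr rfl fun i _ => hterm i]
  split_ifs <;> simp

end Weight

/-! ### The exterior degree of the Koszul complex -/

section Card

variable {S : Type*} [CommRing S] {m : ℕ}

/-- The component of exterior degree `e`. -/
def cardComponent (e : ℕ) (z : Finset (Fin m) → S) : Finset (Fin m) → S :=
  fun I => if I.card = e then z I else 0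

theorem koszulD_cardComponent (f : Fin m → S) (e : ℕ) (z : Finset (Fin m) → S) :
    koszulD f (cardComponent (e + 1) z) = cardComponent e (koszulD f z) := by
  ext J
  unfold cardComponent
  rw [koszulD_apply]
  split_ifs with h
  · rw [koszulD_apply]
    refine Finset.sum_congr rfl fun i _ => ?_
    split_ifs with hi h'
    · rfl
    · rfl
    · rw [Finset.card_insert_of_notMem hi] at h'; omega
  · refine Finset.sum_eq_zero fun i _ => ?_
    split_ifs with hi h'
    · rfl
    · rw [Finset.card_insert_of_notMem hi] at h'; omega
    · simp

/-- The Koszul differential on the basis vector given by a strictly increasing tuple. -/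
theorem koszulD_single_image (f : Fin m → S) {e : ℕ} {t : Fin (e + 1) → Fin m} (ht : StrictMono t)
    (q : S) : koszulD f (Pi.single (Finset.univ.image t) q)
      = ∑ a : Fin (e + 1), (-1 : ℤ) ^ (a : ℕ) •
        Pi.single (Finset.univ.image (t ∘ a.succAbove)) (f (t a) * q) := by
  rw [koszulD_single, Finset.sum_image fun _ _ _ _ h => ht.injective h]
  refine Finset.sum_congr rfl fun a _ => ?_
  have h : (Finset.univ.image t).erase (t a) = Finset.univ.image (t ∘ a.succAbove) := by
    ext j
    simp only [Finset.mem_erase, Finset.mem_image, Finset.mem_univ, true_and, Function.comp_apply]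
    constructor
    · rintro ⟨h1, b, rfl⟩
      obtain ⟨c, rfl⟩ := Fin.exists_succAbove_eq (x := b) (y := a) (fun h => h1 (h ▸ rfl))
      exact ⟨c, rfl⟩
    · rintro ⟨c, rfl⟩
      exact ⟨fun h => Fin.succAbove_ne a c (ht.injective h), _, rfl⟩
  rw [h]
  congr 1
  rw [koszulSign, ← h]
  congr 1
  -- As `t` is increasing, exactly `a` of its values precede `t a`, which identifies the Koszul sign
  -- with `(-1)^a`.
  have h2 : ((Finset.univ.image t).erase (t a)).filter (· < t a) = (Finset.Iio a).image t := by
    ext j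
    simp only [Finset.mem_filter, Finset.mem_erase, Finset.mem_image, Finset.mem_univ, true_and,
      Finset.mem_Iio]
    constructor
    · rintro ⟨⟨_, b, rfl⟩, h⟩
      exact ⟨b, ht.lt_iff_lt.mp h, rfl⟩
    · rintro ⟨b, hb, rfl⟩
      exact ⟨⟨(ht hb).ne, b, rfl⟩, ht hb⟩
  rw [h2, Finset.card_image_of_injective _ ht.injective, Fin.card_Iio]

end Card

end

noncomputable section

/-! ### The Spencer complex over `R` in coordinates -/

variable {n p m : ℕ} {L : LieRinehartSubalgebra (PolyRing n) (F1 n p)}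

/-- The element `P ⊗ (v₁ ∧ ⋯ ∧ v_e)` of `Sp_{R,r}^{-e}`. -/
def SpR.mk (P : DiffOp n p) {e : ℕ} (v : Fin e → L) : SpR L e :=
  BaseChange.mk _ P (Sp.mk 1 v)

/-- `SpR.mk P` as an alternating map. -/
def SpR.mkAlt (P : DiffOp n p) (e : ℕ) : L [⋀^Fin e]→ₗ[ℤ] SpR L e :=
  (BaseChange.mkHom (envToDiffOp L).toRingHom P).toIntLinearMap.compAlternatingMap
    (Sp.mkAlt (1 : EnvAlg (PolyRing n) L))

theorem SpR.mkAlt_apply (P : DiffOp n p) {e : ℕ} (v : Fin e → L) :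
    SpR.mkAlt P e v = SpR.mk P v := rfl

theorem SpR.smul_mk (P Q : DiffOp n p) {e : ℕ} (v : Fin e → L) :
    P • SpR.mk Q v = SpR.mk (P * Q) v := BaseChange.smul_mk _ _ _ _

theorem envToDiffOp_lieToEnv (x : L) :
    envToDiffOp L (lieToEnv x) = ((x : F1 n p) : DiffOp n p) :=
  EnvAlg.lift_lieToEnv _ _ _ _ _ _ _

theorem envToDiffOp_polyToEnv (a : PolyRing n) :
    envToDiffOp L (polyToEnv (PolyRing n) L a) = ofPoly n p a :=
  EnvAlg.lift_polyToEnv _ _ _ _ _ _ _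

theorem mk_sp_mk (P : DiffOp n p) (Q : EnvAlg (PolyRing n) L) {e : ℕ} (v : Fin e → L) :
    BaseChange.mk (envToDiffOp L).toRingHom P (Sp.mk Q v) = SpR.mk (P * envToDiffOp L Q) v := by
  rw [SpR.mk, ← mul_one Q, ← Sp.smul_mk, mul_one, ← BaseChange.mk_mul]
  rfl

theorem SpR.mk_cons_smul (P : DiffOp n p) {e : ℕ} (a : PolyRing n) (x : L) (v : Fin e → L) :
    SpR.mk P (Fin.cons (a • x) v : Fin (e + 1) → L)
      = SpR.mk (P * ofPoly n p a) (Fin.cons x v : Fin (e + 1) → L) := by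
  rw [SpR.mk, Sp.mk_cons_smul, one_mul, mk_sp_mk, envToDiffOp_polyToEnv]

theorem spencerRD_mk (P : DiffOp n p) {e : ℕ} (v : Fin (e + 1) → L) :
    spencerRD L e (SpR.mk P v)
      = BaseChange.mkHom (envToDiffOp L).toRingHom P (spencerAlt (A := PolyRing n) e v) := by
  unfold spencerRD SpR.mk
  rw [BaseChange.map_mk, spencerD_mk_eq, one_smul]
  rfl

theorem mk_spencerFst (P : DiffOp n p) {e : ℕ} (v : Fin (e + 1) → L) :
    BaseChange.mkHom (envToDiffOp L).toRingHom P (spencerFst (A := PolyRing n) e v)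
      = ∑ a : Fin (e + 1), (-1 : ℤ) ^ (a : ℕ) •
        SpR.mk (P * ((v a : F1 n p) : DiffOp n p)) (v ∘ a.succAbove) := by
  rw [spencerFst_apply, map_sum]
  refine Finset.sum_congr rfl fun a _ => ?_
  rw [map_zsmul, BaseChange.mkHom_apply, mk_sp_mk, envToDiffOp_lieToEnv]
  rfl

theorem mk_spencerSnd (P : DiffOp n p) {e : ℕ} (v : Fin (e + 2) → L) :
    BaseChange.mkHom (envToDiffOp L).toRingHom P (spencerSnd (A := PolyRing n) e v)
      = ∑ i : Fin (e + 1), ∑ j ≥ i, (-1 : ℤ) ^ (i + (j + 1) : ℕ) •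
        SpR.mk P (Fin.cons ⁅v i.castSucc, v j.succ⁆ (v ∘ i.castSucc.succAbove ∘ j.succAbove) :
          Fin (e + 1) → L) := by
  rw [spencerSnd_apply, map_sum]
  refine Finset.sum_congr rfl fun i _ => ?_
  rw [map_sum]
  refine Finset.sum_congr rfl fun j _ => ?_
  rw [map_zsmul]
  rfl

theorem BaseChange.map_map_eq_zero {B S M M' M'' : Type*} [Ring B] [Ring S] (φ : B →+* S)
    [AddCommGroup M] [Module B M] [AddCommGroup M'] [Module B M'] [AddCommGroup M'']
    [Module B M''] {f : M →ₗ[B] M'} {g : M' →ₗ[B] M''} (h : g ∘ₗ f = 0) (z : BaseChange φ M) :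
    BaseChange.map φ g (BaseChange.map φ f z) = 0 := by
  have h1 : BaseChange.map φ g ∘ₗ BaseChange.map φ f = 0 := by
    refine BaseChange.hom_ext fun ω => ?_
    have h2 : g (f ω) = 0 := LinearMap.congr_fun h ω
    rw [LinearMap.comp_apply, BaseChange.map_mk, BaseChange.map_mk, h2, LinearMap.zero_apply,
      ← BaseChange.mkHom_apply, map_zero]
  exact LinearMap.congr_fun h1 z

theorem spencerRD_comp_spencerRD (e : ℕ) (z : SpR L (e + 2)) :
    spencerRD L e (spencerRD L (e + 1) z) = 0 :=
  BaseChange.map_map_eq_zero _ (spencerD_comp_spencerD e) z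

/-- The basis of `Sp_{R,r}^{-e}` given by a basis of `L`. -/
def spRBasis (b : Module.Basis (Fin m) (PolyRing n) L) (e : ℕ) :
    Module.Basis (Set.powersetCard (Fin m) e) (DiffOp n p) (SpR L e) :=
  BaseChange.basis _ (BaseChange.basis _ (b.exteriorPower e))

theorem spRBasis_apply (b : Module.Basis (Fin m) (PolyRing n) L) (e : ℕ)
    (s : Set.powersetCard (Fin m) e) :
    spRBasis b e s = SpR.mk 1 (b ∘ Set.powersetCard.ofFinEmbEquiv.symm s) := by
  unfold spRBasis SpR.mk Sp.mk
  rw [BaseChange.basis_apply, BaseChange.basis_apply, exteriorPower.basis_apply]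
  rfl

/-- The total symbols of the coordinates. -/
def symbolCoord (b : Module.Basis (Fin m) (PolyRing n) L) (e : ℕ) :
    SpR L e →+ (Finset (Fin m) → GrRing n p) where
  toFun z I := if h : I.card = e then
    totalSymbol n p ((spRBasis b e).repr z (Set.powersetCard.ofCard h)) else 0
  map_zero' := by ext1 I; simp
  map_add' y z := by
    ext1 I
    rw [Pi.add_apply]
    split_ifs <;> simp

theorem symbolCoord_apply (b : Module.Basis (Fin m) (PolyRing n) L) (e : ℕ) (z : SpR L e)
    (I : Finset (Fin m)) : symbolCoord b e z I = if h : I.card = e then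
    totalSymbol n p ((spRBasis b e).repr z (Set.powersetCard.ofCard h)) else 0 := rfl

theorem symbolCoord_injective (b : Module.Basis (Fin m) (PolyRing n) L) (e : ℕ) :
    Function.Injective (symbolCoord b e) := by
  rw [injective_iff_map_eq_zero]
  intro z hz
  rw [← (spRBasis b e).repr.map_eq_zero_iff]
  ext s
  have h := congrFun hz s.val
  rw [symbolCoord_apply, dif_pos (Set.powersetCard.card_eq s)] at h
  exact (totalSymbol n p).map_eq_zero_iff.mp h

/-- Used to lift a Koszul primitive to a Spencer chain, by quantizing each coordinate. -/
theorem exists_symbolCoord_eq (b : Module.Basis (Fin m) (PolyRing n) L) (e : ℕ)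
    (z : Finset (Fin m) → GrRing n p) (hz : ∀ I, I.card ≠ e → z I = 0) :
    ∃ y, symbolCoord b e y = z := by
  refine ⟨(spRBasis b e).equivFun.symm fun s => quantize n p (z s.val), ?_⟩
  ext1 I
  rw [symbolCoord_apply]
  split_ifs with h
  · rw [← Module.Basis.equivFun_apply, LinearEquiv.apply_symm_apply, totalSymbol_quantize]
    rfl
  · exact (hz I h).symm

theorem symbolCoord_smul_basis (b : Module.Basis (Fin m) (PolyRing n) L) (e : ℕ) (P : DiffOp n p)
    (s : Set.powersetCard (Fin m) e) :
    symbolCoord b e (P • spRBasis b e s) = Pi.single s.val (totalSymbol n p P) := by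
  ext1 I
  rw [symbolCoord_apply, map_smul, Module.Basis.repr_self]
  by_cases hI : I = s.val
  · subst hI
    rw [dif_pos (Set.powersetCard.card_eq s), Pi.single_eq_same, Finsupp.smul_apply, Set.powersetCard.ofCard_coe,
      Finsupp.single_eq_same, smul_eq_mul, mul_one]
  · rw [Pi.single_eq_of_ne hI]
    split_ifs with h
    · rw [Finsupp.smul_apply, Finsupp.single_eq_of_ne, smul_zero, map_zero]
      exact fun h' => hI (congrArg Subtype.val h')
    · rfl

theorem symbolCoord_mk_strictMono (b : Module.Basis (Fin m) (PolyRing n) L) {e : ℕ}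
    (P : DiffOp n p) {t : Fin e → Fin m} (ht : StrictMono t) :
    symbolCoord b e (SpR.mk P (b ∘ t))
      = Pi.single (Finset.univ.image t) (totalSymbol n p P) := by
  set s := Set.powersetCard.ofFinEmbEquiv (OrderEmbedding.ofStrictMono t ht) with hs
  have h1 : SpR.mk P (b ∘ t) = P • spRBasis b e s := by
    rw [spRBasis_apply, SpR.smul_mk, mul_one, hs, Equiv.symm_apply_apply]
    rfl
  have h2 : s.val = Finset.univ.image t := by
    ext j
    rw [hs, Set.powersetCard.mem_coe_iff, Set.powersetCard.mem_ofFinEmbEquiv_iff_mem_range]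
    simp
  rw [h1, symbolCoord_smul_basis, h2]

/-- Weight estimate for an arbitrary tuple of basis vectors: a repetition gives zero, and otherwise
sorting the tuple only changes the sign. -/
theorem symbolCoord_mk_mem (b : Module.Basis (Fin m) (PolyRing n) L) (o : Fin m → ℕ) {e : ℕ}
    {P : DiffOp n p} {k l : ℕ} (hP : totalSymbol n p P ∈ degLT n p k) (t : Fin e → Fin m)
    (hl : k + ∑ a, o (t a) ≤ l) :
    symbolCoord b e (SpR.mk P (b ∘ t)) ∈ weightLT o n p l := by
  by_cases ht : Function.Injective t
  · obtain ⟨t', ht', π, rfl⟩ : ∃ t' : Fin e → Fin m, StrictMono t' ∧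
        ∃ π : Equiv.Perm (Fin e), t' ∘ π = t := by
      refine ⟨t ∘ Tuple.sort t, (Tuple.monotone_sort t).strictMono_of_injective
        (ht.comp (Equiv.injective _)), (Tuple.sort t)⁻¹, ?_⟩
      ext1 a
      simp
    have h1 := (SpR.mkAlt (L := L) P e).map_perm (b ∘ t') π
    rw [SpR.mkAlt_apply, SpR.mkAlt_apply, Function.comp_assoc] at h1
    rw [h1]
    have h2 : symbolCoord b e (SpR.mk P (b ∘ t')) ∈ weightLT o n p l := by
      rw [symbolCoord_mk_strictMono b P ht']
      refine single_mem_weightLT hP (le_trans (le_of_eq ?_) hl)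
      rw [Finset.sum_image fun _ _ _ _ h => ht'.injective h]
      congr 1
      exact (Equiv.sum_comp π fun a => o (t' a)).symm
    rcases Int.units_eq_one_or (Equiv.Perm.sign π) with h | h
    · rw [h, one_smul]; exact h2
    · rw [h, Units.neg_smul, one_smul, map_neg]; exact neg_mem h2
  · rw [Function.not_injective_iff] at ht
    obtain ⟨a, c, hac, hne⟩ := ht
    have h := (SpR.mkAlt (L := L) P e).map_eq_zero_of_eq (b ∘ t)
      (congrArg b hac) hne
    rw [SpR.mkAlt_apply] at h
    rw [h, map_zero]
    exact zero_mem _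

/-- Meant for a bracket in the first slot. It is expanded in the basis; its coefficients become
polynomial right factors of `P`, which do not raise the degree, and `d` bounds the orders of the
basis vectors that occur. -/
theorem symbolCoord_mk_cons_mem (b : Module.Basis (Fin m) (PolyRing n) L) (o : Fin m → ℕ) {e : ℕ}
    {P : DiffOp n p} {k l d : ℕ} (hP : totalSymbol n p P ∈ degLT n p k) (x : L)
    (hx : ∀ i, b.repr x i ≠ 0 → o i ≤ d) (t : Fin e → Fin m)
    (hl : k + (d + ∑ a, o (t a)) ≤ l) :
    symbolCoord b (e + 1) (SpR.mk P (Fin.cons x (b ∘ t) : Fin (e + 1) → L))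
      ∈ weightLT o n p l := by
  have h1 : SpR.mk P (Fin.cons x (b ∘ t) : Fin (e + 1) → L)
      = ∑ i, SpR.mk (P * ofPoly n p (b.repr x i)) (b ∘ (Fin.cons i t : Fin (e + 1) → Fin m)) := by
    let F : L →+ SpR L (e + 1) := AddMonoidHom.mk'
      (fun y => SpR.mk P (Fin.cons y (b ∘ t) : Fin (e + 1) → L))
      fun y z => (SpR.mkAlt (L := L) P (e + 1)).map_vecCons_add (b ∘ t) y z
    change F x = _
    conv_lhs => rw [← b.sum_repr x]
    rw [map_sum]
    refine Finset.sum_congr rfl fun i _ => ?_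
    refine (SpR.mk_cons_smul P _ (b i) (b ∘ t)).trans ?_
    congr 1
    ext1 a
    refine Fin.cases ?_ (fun a => ?_) a <;> simp
  rw [h1, map_sum]
  refine sum_mem fun i _ => ?_
  by_cases hi : b.repr x i = 0
  · have h3 : SpR.mk (P * ofPoly n p 0) (b ∘ (Fin.cons i t : Fin (e + 1) → Fin m)) = 0 := by
      have := SpR.smul_mk 0 1 (b ∘ (Fin.cons i t : Fin (e + 1) → Fin m))
      rw [zero_smul, zero_mul] at this
      rw [map_zero, mul_zero, this]
    rw [hi, h3, map_zero]
    exact zero_mem _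
  · refine symbolCoord_mk_mem b o (totalSymbol_mul_ofPoly_mem hP _) _ (le_trans ?_ hl)
    rw [Fin.sum_univ_succ]
    simp only [Fin.cons_zero, Fin.cons_succ]
    have := hx i hi
    omega

end

noncomputable section

/-! ### Comparison of the Spencer complex with the Koszul complex -/

variable {n p m : ℕ} {L : LieRinehartSubalgebra (PolyRing n) (F1 n p)}

/-- A basis of `L` is adapted to the orders `o` if the `i`-th element has order at most `o i` and the
bracket lowers the total order. -/
structure IsAdapted (b : Module.Basis (Fin m) (PolyRing n) L) (o : Fin m → ℕ) : Prop where
  le_one : ∀ i, o i ≤ 1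
  mem : ∀ i, ((b i : F1 n p) : DiffOp n p) ∈ orderFiltration n p (o i)
  lie : ∀ i j k, i ≠ j → b.repr ⁅b i, b j⁆ k ≠ 0 → o k + 1 ≤ o i + o j

/-- The symbols of the elements of a basis of `L`. -/
def basisSymbol (b : Module.Basis (Fin m) (PolyRing n) L) (o : Fin m → ℕ) (i : Fin m) :
    GrRing n p :=
  symbol (o i) ((b i : F1 n p) : DiffOp n p)

theorem basisSymbol_isHomogeneous (b : Module.Basis (Fin m) (PolyRing n) L) (o : Fin m → ℕ)
    (i : Fin m) : (basisSymbol b o i).IsHomogeneous (o i) := symbol_isHomogeneous _ _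

variable {b : Module.Basis (Fin m) (PolyRing n) L} {o : Fin m → ℕ}

/-- The weight of the chain is at most `l`, and the error has weight strictly less than `l`: this is
the gain of one from `totalSymbol_mul_sub_mem`. -/
theorem IsAdapted.symbolCoord_spencerFst (h : IsAdapted b o) {e j l : ℕ} {t : Fin (e + 1) → Fin m}
    (ht : StrictMono t) {P : DiffOp n p} (hP : totalSymbol n p P ∈ degLT n p (j + 1))
    (hl : j + ∑ a, o (t a) ≤ l) :
    symbolCoord b e (BaseChange.mkHom (envToDiffOp L).toRingHom P
        (spencerFst (A := PolyRing n) e (b ∘ t)))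
      - koszulD (basisSymbol b o) (Pi.single (Finset.univ.image t) (totalSymbol n p P))
      ∈ weightLT o n p l := by
  rw [mk_spencerFst, koszulD_single_image _ ht, map_sum, ← Finset.sum_sub_distrib]
  refine sum_mem fun a _ => ?_
  have ht' : StrictMono (t ∘ a.succAbove) := ht.comp (Fin.strictMono_succAbove a)
  suffices hmem : symbolCoord b e (SpR.mk (P * ((b (t a) : F1 n p) : DiffOp n p))
      (b ∘ t ∘ a.succAbove)) - Pi.single (Finset.univ.image (t ∘ a.succAbove))
        (basisSymbol b o (t a) * totalSymbol n p P) ∈ weightLT o n p l by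
    have h1 := zsmul_mem hmem ((-1 : ℤ) ^ (a : ℕ))
    rw [zsmul_sub] at h1
    rw [map_zsmul]
    exact h1
  rw [symbolCoord_mk_strictMono b _ ht', ← Pi.single_sub]
  refine single_mem_weightLT (totalSymbol_mul_sub_mem (h.le_one (t a)) (h.mem (t a)) hP)
    (le_trans (le_of_eq ?_) hl)
  rw [Finset.sum_image fun _ _ _ _ h => ht'.injective h, Fin.sum_univ_succAbove _ a, add_assoc]
  rfl

theorem IsAdapted.symbolCoord_spencerSnd (h : IsAdapted b o) {e j l : ℕ} {t : Fin (e + 2) → Fin m}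
    (ht : Function.Injective t) {P : DiffOp n p} (hP : totalSymbol n p P ∈ degLT n p (j + 1))
    (hl : j + ∑ a, o (t a) ≤ l) :
    symbolCoord b (e + 1) (BaseChange.mkHom (envToDiffOp L).toRingHom P
        (spencerSnd (A := PolyRing n) e (b ∘ t))) ∈ weightLT o n p l := by
  rw [mk_spencerSnd, map_sum]
  refine sum_mem fun i _ => ?_
  rw [map_sum]
  refine sum_mem fun k hk => ?_
  rw [map_zsmul]
  refine zsmul_mem ?_ _
  -- Since `k ≥ i`, position `k` after removal of `i` is position `k + 1` of the original tuple.
  have hik : i.castSucc.succAbove k = k.succ :=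
    Fin.succAbove_of_le_castSucc _ _ (Fin.castSucc_le_castSucc_iff.mpr (Finset.mem_Ici.mp hk))
  have hne : t i.castSucc ≠ t k.succ := by
    rw [← hik]
    exact fun h => Fin.succAbove_ne _ _ (ht h).symm
  have hsum : ∑ a, o (t a) = o (t i.castSucc) + (o (t k.succ)
      + ∑ a, o (t (i.castSucc.succAbove (k.succAbove a)))) := by
    rw [Fin.sum_univ_succAbove _ i.castSucc, Fin.sum_univ_succAbove _ k, hik]
  -- If both orders were `0`, the subtraction of `1` in `d` below would be truncated; in that case
  -- adaptedness forces the bracket to vanish.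
  by_cases h0 : o (t i.castSucc) + o (t k.succ) = 0
  · have hz : (⁅b (t i.castSucc), b (t k.succ)⁆ : L) = 0 := by
      refine b.repr.map_eq_zero_iff.mp (Finsupp.ext fun c => ?_)
      by_contra hc
      have := h.lie _ _ c hne hc
      omega
    have h1 : SpR.mk P (Fin.cons ⁅(b ∘ t) i.castSucc, (b ∘ t) k.succ⁆
        ((b ∘ t) ∘ i.castSucc.succAbove ∘ k.succAbove) : Fin (e + 1) → L) = 0 :=
      (SpR.mkAlt (L := L) P (e + 1)).map_coord_zero 0 hz
    rw [h1, map_zero]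
    exact zero_mem _
  · exact symbolCoord_mk_cons_mem b o hP _ (d := o (t i.castSucc) + o (t k.succ) - 1)
      (fun c hc => by
        have := h.lie _ _ c hne hc
        omega) (t ∘ i.castSucc.succAbove ∘ k.succAbove) (by
        simp only [Function.comp_apply]
        omega)

theorem spencerAlt_succ_apply {A L V : Type*} [CommRing A] [Algebra ℂ A] [LieRing L]
    [LieAlgebra ℂ L] [Module A L] [LieRingModule L A] [LieRinehartRing A L]
    [LieRinehartAlgebra ℂ A L] [AddCommGroup V] {e : ℕ} (F : Sp A L (e + 1) →+ V)
    (v : Fin (e + 2) → L) :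
    F (spencerAlt (A := A) (e + 1) v)
      = F (spencerFst (A := A) (e + 1) v) + F (spencerSnd (A := A) e v) := by
  rw [← map_add]
  rfl

theorem map_mem_of_basis {ι S M V : Type*} [Finite ι] [Ring S] [AddCommGroup M] [Module S M]
    [AddCommGroup V] (β : Module.Basis ι S M) (G : M →+ V) (W : AddSubgroup V) (z : M)
    (h : ∀ s, β.repr z s ≠ 0 → G (β.repr z s • β s) ∈ W) : G z ∈ W := by
  have := Fintype.ofFinite ι
  rw [← β.sum_repr z, map_sum]
  refine sum_mem fun s _ => ?_
  by_cases hs : β.repr z s = 0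
  · rw [hs, zero_smul, map_zero]
    exact zero_mem W
  · exact h s hs

/-- The difference between the Spencer and the Koszul differentials. -/
def spencerSubKoszul (b : Module.Basis (Fin m) (PolyRing n) L) (o : Fin m → ℕ) (e : ℕ) :
    SpR L (e + 1) →+ (Finset (Fin m) → GrRing n p) :=
  (symbolCoord b e).comp (spencerRD L e).toAddMonoidHom
    - (koszulD (basisSymbol b o)).toAddMonoidHom.comp (symbolCoord b (e + 1))

theorem spencerSubKoszul_apply (e : ℕ) (z : SpR L (e + 1)) :
    spencerSubKoszul b o e z = symbolCoord b e (spencerRD L e z)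
      - koszulD (basisSymbol b o) (symbolCoord b (e + 1) z) := rfl

theorem IsAdapted.spencerSubKoszul_mk_mem (h : IsAdapted b o) {e j l : ℕ}
    {t : Fin (e + 1) → Fin m} (ht : StrictMono t) {P : DiffOp n p}
    (hP : totalSymbol n p P ∈ degLT n p (j + 1)) (hl : j + ∑ a, o (t a) ≤ l) :
    spencerSubKoszul b o e (SpR.mk P (b ∘ t)) ∈ weightLT o n p l := by
  have hK : koszulD (basisSymbol b o) (symbolCoord b (e + 1) (SpR.mk P (b ∘ t)))
      = koszulD (basisSymbol b o) (Pi.single (Finset.univ.image t) (totalSymbol n p P)) :=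
    congrArg _ (symbolCoord_mk_strictMono b P ht)
  have hd : symbolCoord b e (spencerRD L e (SpR.mk P (b ∘ t)))
      = symbolCoord b e (BaseChange.mkHom (envToDiffOp L).toRingHom P
          (spencerAlt (A := PolyRing n) e (b ∘ t))) :=
    congrArg _ (spencerRD_mk P (b ∘ t))
  rw [spencerSubKoszul_apply, hK, hd]
  cases e with
  | zero => exact h.symbolCoord_spencerFst ht hP hl
  | succ e =>
    have h1 := add_mem (h.symbolCoord_spencerFst ht hP hl)
      (h.symbolCoord_spencerSnd ht.injective hP hl)
    have hadd := spencerAlt_succ_apply (A := PolyRing n) ((symbolCoord b (e + 1)).comp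
      (BaseChange.mkHom (envToDiffOp L).toRingHom P)) (b ∘ t)
    simp only [AddMonoidHom.comp_apply] at hadd
    rw [hadd, add_sub_right_comm]
    exact h1

/-- The graded version of the Spencer differential is the Koszul differential. By additivity it
suffices to treat one basis component of `z` at a time. -/
theorem IsAdapted.symbolCoord_spencerRD (h : IsAdapted b o) {e l : ℕ} {z : SpR L (e + 1)}
    (hz : symbolCoord b (e + 1) z ∈ weightLT o n p (l + 1)) :
    symbolCoord b e (spencerRD L e z) - koszulD (basisSymbol b o) (symbolCoord b (e + 1) z)
      ∈ weightLT o n p l := by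
  rw [← spencerSubKoszul_apply]
  refine map_mem_of_basis (spRBasis b (e + 1)) _ _ z fun s hP0 => ?_
  set P := (spRBasis b (e + 1)).repr z s with hP
  set t : Fin (e + 1) → Fin m := ⇑(Set.powersetCard.ofFinEmbEquiv.symm s)
  have ht : StrictMono t := (Set.powersetCard.ofFinEmbEquiv.symm s).strictMono
  have hw : ∑ i ∈ s.val, o i = ∑ a, o (t a) := by
    have hs : s.val = Finset.univ.image t := by
      ext j
      rw [Set.powersetCard.mem_coe_iff, ← Set.powersetCard.mem_range_ofFinEmbEquiv_symm_iff_mem]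
      simp [t]
    rw [hs, Finset.sum_image fun _ _ _ _ h => ht.injective h]
  have hzP : symbolCoord b (e + 1) z s.val = totalSymbol n p P := by
    rw [symbolCoord_apply, dif_pos (Set.powersetCard.card_eq s)]
    rfl
  -- Otherwise the wedge alone exceeds the allowed weight and the coefficient `P` would vanish.
  have hl : ∑ a, o (t a) ≤ l := by
    by_contra hl
    refine hP0 ((totalSymbol n p).map_eq_zero_iff.mp ?_)
    rw [← hzP]
    ext1 α
    rw [hz _ α (by omega), coeff_zero]
  obtain ⟨j, rfl⟩ := Nat.exists_eq_add_of_le' hl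
  have hmk : P • spRBasis b (e + 1) s = SpR.mk P (b ∘ t) := by
    rw [spRBasis_apply, SpR.smul_mk, mul_one]
  rw [hmk]
  refine h.spencerSubKoszul_mk_mem ht (fun α hα => ?_) le_rfl
  rw [← hzP]
  exact hz _ α (by omega)

/-! ### Strictness of the differential and exactness of the Spencer complex -/

theorem symbolCoord_eq_zero {e : ℕ} (z : SpR L e) {I : Finset (Fin m)} (hI : I.card ≠ e) :
    symbolCoord b e z I = 0 := by
  rw [symbolCoord_apply, dif_neg hI]

/-- The differential of the Spencer complex is strict with respect to the filtrations. -/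
theorem IsAdapted.exists_sub_mem (h : IsAdapted b o)
    (hreg : RingTheory.Sequence.IsWeaklyRegular (GrRing n p) (List.ofFn (basisSymbol b o)))
    {e l : ℕ} {z : SpR L (e + 1)} (hz : symbolCoord b (e + 1) z ∈ weightLT o n p (l + 1))
    (hdz : symbolCoord b e (spencerRD L e z) ∈ weightLT o n p l) :
    ∃ y : SpR L (e + 2), symbolCoord b (e + 1) (z - spencerRD L (e + 1) y) ∈ weightLT o n p l := by
  have hf := basisSymbol_isHomogeneous b o
  set ζ := symbolCoord b (e + 1) z with hζ
  set g := weightComponent o l ζ with hg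
  -- The Koszul and Spencer differentials of `z` agree modulo weight `< l`, and the latter is small
  -- by assumption; so the weight `l` part `g` is a Koszul cycle.
  have hKζ : koszulD (basisSymbol b o) ζ ∈ weightLT o n p l := by
    have := sub_mem hdz (h.symbolCoord_spencerRD hz)
    rwa [sub_sub_cancel] at this
  have hKg : koszulD (basisSymbol b o) g = 0 := by
    rw [hg, koszulD_weightComponent hf, weightComponent_eq_zero hKζ]
  have hcard : ∀ I : Finset (Fin m), I.card ≠ e + 1 → g I = 0 := by
    intro I hI
    ext1 α
    have hζI : ζ I = 0 := symbolCoord_eq_zero z hI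
    rw [hg, coeff_weightComponent, hζI, coeff_zero, ite_self]
  obtain ⟨w, hw⟩ := koszulD_exact (basisSymbol b o) hreg g hKg (hcard ∅ (by simp))
  -- Exactness gives an arbitrary primitive. Its bihomogeneous part is again a primitive of `g`, and
  -- it is the coordinate family of a chain `y` of weight at most `l`.
  set w' := cardComponent (e + 2) (weightComponent o l w) with hw'
  have hKw' : koszulD (basisSymbol b o) w' = g := by
    rw [hw', koszulD_cardComponent, koszulD_weightComponent hf, hw]
    ext1 I
    unfold cardComponent
    split_ifs with hI
    · ext1 α
      rw [coeff_weightComponent, hg, coeff_weightComponent]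
      split_ifs <;> rfl
    · exact (hcard I hI).symm
  obtain ⟨y, hy⟩ := exists_symbolCoord_eq b (e + 2) w' fun I hI => if_neg hI
  have hyw : symbolCoord b (e + 2) y ∈ weightLT o n p (l + 1) := by
    rw [hy]
    intro I α hα
    rw [hw', cardComponent]
    split_ifs
    · exact weightComponent_mem o l w I α hα
    · exact coeff_zero α
  refine ⟨y, ?_⟩
  have h1 := h.symbolCoord_spencerRD hyw
  rw [hy, hKw'] at h1
  have h2 := sub_mem (sub_weightComponent_mem hz) h1
  rw [← hg, sub_sub_sub_cancel_right] at h2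
  rwa [map_sub]

/-- Repeats the correction by boundaries until the weight of `z` matches that of its differential.
The case `l = 0` yields exactness and `l = k + 1` the statement on symbols of order `k`. -/
theorem IsAdapted.exists_spencerRD_eq (h : IsAdapted b o)
    (hreg : RingTheory.Sequence.IsWeaklyRegular (GrRing n p) (List.ofFn (basisSymbol b o)))
    {e : ℕ} (l : ℕ) {z : SpR L (e + 1)} (hdz : symbolCoord b e (spencerRD L e z) ∈ weightLT o n p l) :
    ∃ y : SpR L (e + 2), symbolCoord b (e + 1) (z - spencerRD L (e + 1) y) ∈ weightLT o n p l := by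
  obtain ⟨k, hk⟩ := exists_mem_weightLT o (symbolCoord b (e + 1) z)
  induction k generalizing z with
  | zero =>
    refine ⟨0, ?_⟩
    rw [map_zero, sub_zero]
    exact weightLT_mono o (Nat.zero_le l) hk
  | succ k ih =>
    by_cases hkl : k + 1 ≤ l
    · refine ⟨0, ?_⟩
      rw [map_zero, sub_zero]
      exact weightLT_mono o hkl hk
    · obtain ⟨y, hy⟩ := h.exists_sub_mem hreg hk (weightLT_mono o (by omega) hdz)
      obtain ⟨y', hy'⟩ := ih (z := z - spencerRD L (e + 1) y)
        (by rw [map_sub, spencerRD_comp_spencerRD, sub_zero]; exact hdz) hy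
      refine ⟨y + y', ?_⟩
      rwa [map_add, ← sub_sub]

theorem IsAdapted.exact (h : IsAdapted b o)
    (hreg : RingTheory.Sequence.IsWeaklyRegular (GrRing n p) (List.ofFn (basisSymbol b o)))
    (e : ℕ) : Function.Exact (spencerRD L (e + 1)) (spencerRD L e) := by
  intro z
  constructor
  · intro hz
    obtain ⟨y, hy⟩ := h.exists_spencerRD_eq hreg 0 (z := z) (by rw [hz, map_zero]; exact zero_mem _)
    refine ⟨y, (sub_eq_zero.mp (symbolCoord_injective b _ ?_)).symm⟩
    rw [weightLT_zero o hy, map_zero]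
  · rintro ⟨y, rfl⟩
    exact spencerRD_comp_spencerRD e y

/-! ### The augmentation -/

theorem spRZeroToDiffOp_spRMk (P : DiffOp n p) (v : Fin 0 → L) :
    spRZeroToDiffOp L (SpR.mk P v) = P := by
  unfold SpR.mk
  rw [spRZeroToDiffOp_mk, map_one, mul_one]

/-- In degree `0` the only coordinate is the one at `∅`; this makes the order filtration of `R` the
weight filtration there. -/
theorem totalSymbol_spRZeroToDiffOp (b : Module.Basis (Fin m) (PolyRing n) L) (z : SpR L 0) :
    totalSymbol n p (spRZeroToDiffOp L z) = symbolCoord b 0 z ∅ := by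
  have hz : z = SpR.mk (spRZeroToDiffOp L z) (b ∘ (Fin.elim0 : Fin 0 → Fin m)) := by
    have h1 := (spRBasis b 0).sum_repr z
    have h2 : ∀ s, (spRBasis b 0) s = SpR.mk 1 (b ∘ (Fin.elim0 : Fin 0 → Fin m)) := by
      intro s
      rw [spRBasis_apply]
      congr 1
      exact Subsingleton.elim _ _
    simp only [h2, ← Finset.sum_smul] at h1
    rw [SpR.smul_mk, mul_one] at h1
    conv_lhs => rw [← h1]
    conv_rhs => rw [← h1, spRZeroToDiffOp_spRMk]
  have h3 := symbolCoord_mk_strictMono b (spRZeroToDiffOp L z) (t := Fin.elim0)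
    (fun a => a.elim0)
  rw [← hz] at h3
  rw [h3, Finset.univ_eq_empty, Finset.image_empty, Pi.single_eq_same]

theorem spRZeroToDiffOp_injective (b : Module.Basis (Fin m) (PolyRing n) L) :
    Function.Injective (spRZeroToDiffOp L) := by
  rw [injective_iff_map_eq_zero]
  intro z hz
  refine symbolCoord_injective b 0 ?_
  rw [map_zero]
  ext1 I
  by_cases hI : I = ∅
  · rw [hI, ← totalSymbol_spRZeroToDiffOp, hz, map_zero]; rfl
  · exact symbolCoord_eq_zero z (by simpa using hI)

theorem spRZeroToDiffOp_surjective : Function.Surjective (spRZeroToDiffOp L) :=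
  fun P => ⟨SpR.mk P Fin.elim0, spRZeroToDiffOp_spRMk P _⟩

theorem spRZeroToDiffOp_spencerRD_mk (P : DiffOp n p) (v : Fin 1 → L) :
    spRZeroToDiffOp L (spencerRD L 0 (SpR.mk P v)) = P * ((v 0 : F1 n p) : DiffOp n p) := by
  rw [spencerRD_mk]
  change spRZeroToDiffOp L (BaseChange.mkHom _ P (spencerFst 0 v)) = _
  rw [mk_spencerFst, map_sum, Fin.sum_univ_one]
  simp [spRZeroToDiffOp_spRMk]

theorem range_spRZeroToDiffOp_spencerRD (b : Module.Basis (Fin m) (PolyRing n) L) :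
    LinearMap.range (spRZeroToDiffOp L ∘ₗ spencerRD L 0)
      = Submodule.span (DiffOp n p) (Set.range fun i => ((b i : F1 n p) : DiffOp n p)) := by
  apply le_antisymm
  · rw [LinearMap.range_eq_map, ← (spRBasis b 1).span_eq, Submodule.map_span, Submodule.span_le]
    rintro _ ⟨_, ⟨s, rfl⟩, rfl⟩
    rw [LinearMap.comp_apply, spRBasis_apply, spRZeroToDiffOp_spencerRD_mk, one_mul]
    exact Submodule.subset_span ⟨_, rfl⟩
  · rw [Submodule.span_le]
    rintro _ ⟨i, rfl⟩
    exact ⟨SpR.mk 1 fun _ => b i, by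
      rw [LinearMap.comp_apply, spRZeroToDiffOp_spencerRD_mk, one_mul]⟩

theorem exact_spencerAug (b : Module.Basis (Fin m) (PolyRing n) L) :
    Function.Exact (spencerRD L 0) (spencerAug L
      (Submodule.span (DiffOp n p) (Set.range fun i => ((b i : F1 n p) : DiffOp n p)))) := by
  intro z
  unfold spencerAug
  rw [LinearMap.comp_apply, Submodule.mkQ_apply, Submodule.Quotient.mk_eq_zero,
    ← range_spRZeroToDiffOp_spencerRD b]
  constructor
  · rintro ⟨y, hy⟩
    exact ⟨y, spRZeroToDiffOp_injective b hy⟩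
  · rintro ⟨y, rfl⟩
    exact ⟨y, rfl⟩

theorem spencerAug_surjective (I : Submodule (DiffOp n p) (DiffOp n p)) :
    Function.Surjective (spencerAug L I) :=
  I.mkQ_surjective.comp spRZeroToDiffOp_surjective

/-! ### The ideal of symbols -/

theorem IsAdapted.symbolIdeal_eq (h : IsAdapted b o)
    (hreg : RingTheory.Sequence.IsWeaklyRegular (GrRing n p) (List.ofFn (basisSymbol b o))) :
    symbolIdeal (Submodule.span (DiffOp n p) (Set.range fun i => ((b i : F1 n p) : DiffOp n p)))
      = Ideal.span (Set.range (basisSymbol b o)) := by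
  unfold symbolIdeal
  apply le_antisymm
  · rw [Ideal.span_le]
    rintro _ ⟨k, P, hPI, hPk, rfl⟩
    rw [← range_spRZeroToDiffOp_spencerRD b] at hPI
    obtain ⟨z, hz⟩ := hPI
    rw [LinearMap.comp_apply] at hz
    have hdz : symbolCoord b 0 (spencerRD L 0 z) ∈ weightLT o n p (k + 1) := by
      intro I α hα
      by_cases hI : I = ∅
      · subst hI
        rw [← totalSymbol_spRZeroToDiffOp, hz]
        exact totalSymbol_mem_degLT hPk α (by simpa using hα)
      · rw [symbolCoord_eq_zero _ (by simpa using hI), coeff_zero]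
    -- Changing `z` by a boundary keeps the operator `P` that it represents and removes all terms of
    -- weight above `k`; cancellation among higher symbols is thereby excluded.
    obtain ⟨y, hy⟩ := h.exists_spencerRD_eq hreg (k + 1) hdz
    set z' := z - spencerRD L 1 y with hz'
    have hdz' : spencerRD L 0 z' = spencerRD L 0 z := by
      rw [hz', map_sub, spencerRD_comp_spencerRD, sub_zero]
    -- In weight `k` the Spencer and Koszul differentials of `z'` coincide, so the symbol of `P` is
    -- a combination of the basis symbols.
    have h1 := weightComponent_eq_zero (h.symbolCoord_spencerRD hy)
    have h2 : symbol k P = koszulD (basisSymbol b o)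
        (weightComponent o k (symbolCoord b 1 z')) ∅ := by
      rw [koszulD_weightComponent (basisSymbol_isHomogeneous b o)]
      ext1 α
      have h3 := congrArg (coeff α) (congrFun h1 ∅)
      rw [coeff_weightComponent, Pi.sub_apply, hdz', ← totalSymbol_spRZeroToDiffOp, hz] at h3
      rw [symbol, coeff_homogeneousComponent, coeff_weightComponent]
      simp only [Finset.sum_empty, add_zero] at h3 ⊢
      split_ifs at h3 ⊢ with h4
      · rwa [coeff_sub, Pi.zero_apply, coeff_zero, sub_eq_zero] at h3
      · rfl
    rw [h2, koszulD_empty]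
    exact sum_mem fun i _ => Ideal.mul_mem_right _ _ (Ideal.subset_span ⟨i, rfl⟩)
  · refine Ideal.span_mono ?_
    rintro _ ⟨i, rfl⟩
    exact ⟨o i, _, Submodule.subset_span ⟨i, rfl⟩, h.mem i, rfl⟩

end

noncomputable section

/-! ### The adapted basis given by operators with independent symbols -/

section Adapted

variable {n p m : ℕ} {r : Fin m → F1 n p} {o : Fin m → ℕ}

/-- Take the symbol of order `1` of the sum: terms with `o i = 0` do not contribute, and
independence kills the remaining coefficients. -/
theorem coeff_eq_zero_of_sum_mem_orderFiltration_zero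
    (ho : ∀ i, o i ≤ 1) (hr : ∀ i, (r i : DiffOp n p) ∈ orderFiltration n p (o i))
    (hindep : LinearIndependent (PolyRing n) fun i => symbol (o i) (r i : DiffOp n p))
    {c : Fin m → PolyRing n}
    (hc : ((∑ i, c i • r i : F1 n p) : DiffOp n p) ∈ orderFiltration n p 0) (i : Fin m)
    (hi : o i = 1) : c i = 0 := by
  have h1 : symbol 1 ((∑ i, c i • r i : F1 n p) : DiffOp n p)
      = ∑ i, (if o i = 1 then c i else 0) • symbol (o i) (r i : DiffOp n p) := by
    rw [symbol, AddSubmonoidClass.coe_finsetSum, map_sum, map_sum]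
    refine Finset.sum_congr rfl fun i _ => ?_
    rw [Submodule.coe_smul, map_smul, map_smul]
    split_ifs with h
    · rw [h]; rfl
    · have h0 : o i = 0 := by have := ho i; omega
      have h2 := hr i
      rw [h0] at h2
      have h3 : homogeneousComponent 1 (totalSymbol n p (r i : DiffOp n p)) = 0 := by
        ext1 α
        rw [coeff_homogeneousComponent, coeff_zero]
        split_ifs with hα
        · exact totalSymbol_mem_degLT h2 α hα.ge
        · rfl
      rw [h3, smul_zero, zero_smul]
  have h2 : symbol 1 ((∑ i, c i • r i : F1 n p) : DiffOp n p) = 0 := by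
    ext1 α
    rw [symbol, coeff_homogeneousComponent, coeff_zero]
    split_ifs with hα
    · exact totalSymbol_mem_degLT hc α hα.ge
    · rfl
  rw [h2] at h1
  have h3 := Fintype.linearIndependent_iff.mp hindep _ h1.symm i
  rwa [if_pos hi] at h3

/-- The coefficients with `o i = 1` vanish by the previous lemma. At most one index has order `0`,
so a single term is left, and its symbol is nonzero. -/
theorem linearIndependent_of_symbol
    (ho : ∀ i, o i = 1 ∨ ((i : ℕ) = 0 ∧ o i = 0))
    (hr : ∀ i, (r i : DiffOp n p) ∈ orderFiltration n p (o i))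
    (hindep : LinearIndependent (PolyRing n) fun i => symbol (o i) (r i : DiffOp n p)) :
    LinearIndependent (PolyRing n) r := by
  have ho' : ∀ i, o i ≤ 1 := fun i => by rcases ho i with h | h <;> omega
  rw [Fintype.linearIndependent_iff]
  intro c hc
  have h1 : ∀ i, o i = 1 → c i = 0 :=
    coeff_eq_zero_of_sum_mem_orderFiltration_zero ho' hr hindep (by
      rw [hc]; exact zero_mem _)
  intro i
  rcases ho i with h | ⟨h0, hi⟩
  · exact h1 i h
  · have h2 : c i • r i = 0 := by
      rw [← hc, Finset.sum_eq_single i]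
      · intro j _ hj
        rw [h1 j, zero_smul]
        refine (ho j).resolve_right fun h => hj (Fin.ext (h.1.trans h0.symm))
      · simp
    have h3 : c i • symbol (o i) (r i : DiffOp n p) = 0 := by
      have h4 : c i • (r i : DiffOp n p) = 0 := congrArg Subtype.val h2
      rw [symbol, ← map_smul, ← map_smul, h4, map_zero, map_zero]
    exact (smul_eq_zero.mp h3).resolve_right (hindep.ne_zero i)

theorem exists_isAdapted_basis
    (ho : ∀ i, o i = 1 ∨ ((i : ℕ) = 0 ∧ o i = 0))
    (hr : ∀ i, (r i : DiffOp n p) ∈ orderFiltration n p (o i))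
    (hindep : LinearIndependent (PolyRing n) fun i => symbol (o i) (r i : DiffOp n p))
    (L : LieRinehartSubalgebra (PolyRing n) (F1 n p))
    (hL : L.toSubmodule = Submodule.span (PolyRing n) (Set.range r)) :
    ∃ b : Module.Basis (Fin m) (PolyRing n) L, (∀ i, (b i : F1 n p) = r i) ∧ IsAdapted b o := by
  have ho' : ∀ i, o i ≤ 1 := fun i => by rcases ho i with h | h <;> omega
  have hmem : ∀ i, r i ∈ L := fun i => by
    rw [← LieRinehartSubalgebra.mem_toSubmodule, hL]
    exact Submodule.subset_span ⟨i, rfl⟩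
  let incl : L →ₗ[PolyRing n] F1 n p := L.toSubmodule.subtype
  have hli : LinearIndependent (PolyRing n) fun i => (⟨r i, hmem i⟩ : L) :=
    LinearIndependent.of_comp incl (linearIndependent_of_symbol ho hr hindep)
  have hspan : ⊤ ≤ Submodule.span (PolyRing n) (Set.range fun i => (⟨r i, hmem i⟩ : L)) := by
    rintro ⟨x, hx⟩ -
    have hx' : x ∈ Submodule.span (PolyRing n) (Set.range r) := hL ▸ hx
    have h2 : Submodule.map incl
        (Submodule.span (PolyRing n) (Set.range fun i => (⟨r i, hmem i⟩ : L)))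
        = Submodule.span (PolyRing n) (Set.range r) := by
      rw [Submodule.map_span, ← Set.range_comp]
      rfl
    rw [← h2] at hx'
    obtain ⟨y, hy, hyx⟩ := hx'
    have : y = ⟨x, hx⟩ := Subtype.ext hyx
    rwa [← this]
  let b := Module.Basis.mk hli hspan
  have hb : ∀ i, (b i : F1 n p) = r i := fun i => by simp only [b, Module.Basis.mk_apply]
  refine ⟨b, hb, ho', fun i => by rw [hb]; exact hr i, fun i j k hij hk => ?_⟩
  -- With both orders equal to `1` the required bound `o k + 1 ≤ 2` is automatic. Otherwise one of
  -- the two elements is a polynomial, and its commutator with an element of `F₁R` is again a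
  -- polynomial.
  by_cases h1 : o i = 1 ∧ o j = 1
  · have := ho' k; omega
  · have hlie : ((⁅r i, r j⁆ : F1 n p) : DiffOp n p) ∈ orderFiltration n p 0 := by
      have hpoly : ∀ P : DiffOp n p, P ∈ orderFiltration n p 0 → ∃ a, P = ofPoly n p a := by
        intro P hP
        unfold orderFiltration at hP
        induction hP using Submodule.span_induction with
        | mem P hP =>
          obtain ⟨α, hα, rfl⟩ := hP
          have h0 : α = 0 := (Finsupp.degree_eq_zero_iff α).mp (Nat.le_zero.mp hα)
          exact ⟨1, by rw [h0, opMonomial_zero, map_one]⟩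
        | zero => exact ⟨0, (map_zero _).symm⟩
        | add P Q _ _ hP hQ =>
          obtain ⟨a, rfl⟩ := hP
          obtain ⟨c, rfl⟩ := hQ
          exact ⟨a + c, (map_add _ _ _).symm⟩
        | smul c P _ hP =>
          obtain ⟨a, rfl⟩ := hP
          exact ⟨c * a, (map_mul (ofPoly n p) c a).symm⟩
      have hmem0 : ∀ a, ofPoly n p a ∈ orderFiltration n p 0 := fun a => by
        rw [← mul_one (ofPoly n p a), ← poly_smul_def]
        exact Submodule.smul_mem _ _ (Submodule.subset_span ⟨0, by simp, opMonomial_zero⟩)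
      rw [F1.coe_lie]
      rcases ho i with hi | hi
      · have hj : o j = 0 := ((ho j).resolve_left fun hj => h1 ⟨hi, hj⟩).2
        obtain ⟨a, ha⟩ := hpoly _ (hj ▸ hr j)
        obtain ⟨c, hc⟩ := exists_commutator (r i : DiffOp n p) (r i).2 a
        rw [ha, hc]
        exact hmem0 c
      · obtain ⟨a, ha⟩ := hpoly _ (hi.2 ▸ hr i)
        obtain ⟨c, hc⟩ := exists_commutator (r j : DiffOp n p) (r j).2 a
        rw [ha, ← neg_sub, hc]
        exact neg_mem (hmem0 c)
    have hsum : (∑ k, b.repr ⁅b i, b j⁆ k • r k : F1 n p) = ⁅r i, r j⁆ := by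
      have h2 := congrArg incl (b.sum_repr ⁅b i, b j⁆)
      rw [map_sum] at h2
      have h3 : incl ⁅b i, b j⁆ = ⁅r i, r j⁆ := by
        rw [← hb i, ← hb j]; rfl
      rw [← h3, ← h2]
      refine Finset.sum_congr rfl fun k _ => ?_
      rw [map_smul, ← hb k]
      rfl
    rw [← hsum] at hlie
    -- A bracket of order `0` has no coefficient along the generators of order `1`.
    have hk0 : o k = 0 := by
      by_contra hk0
      exact hk (coeff_eq_zero_of_sum_mem_orderFiltration_zero ho' hr hindep hlie k
        (by have := ho' k; omega))
    -- Only the first index can have order `0`, and `i ≠ j`; so `o i + o j` is at least `1`.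
    have h3 : ¬ (o i = 0 ∧ o j = 0) := by
      rintro ⟨hi, hj⟩
      rcases ho i with h | h
      · omega
      · rcases ho j with h' | h'
        · omega
        · exact hij (Fin.ext (h.1.trans h'.1.symm))
    omega

end Adapted

end

end SpencerResolution


open SpencerResolution in
theorem mainTheorem12
    -- `R = DiffOp n p` is `ℂ[x][∂]` for `p = 0` and `ℂ[x][∂][s]` for `p = 1`
    (n p : ℕ) (hp : p ≤ 1) (m : ℕ)
    -- `r₁, …, r_m ∈ F₁R`; `o i` is the order with which `rᵢ` is considered: it is `1` for all `i`,
    -- except that it may be `0` for the first one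
    (r : Fin m → F1 n p) (o : Fin m → ℕ)
    (ho : ∀ i, o i = 1 ∨ ((i : ℕ) = 0 ∧ o i = 0))
    (hr : ∀ i, (r i : DiffOp n p) ∈ orderFiltration n p (o i))
    (hindep : LinearIndependent (PolyRing n) fun i => symbol (o i) (r i : DiffOp n p))
    -- the `ℂ[x]`-module `L` generated by the `rᵢ` is closed under the Lie bracket
    (L : LieRinehartSubalgebra (PolyRing n) (F1 n p))
    (hL : L.toSubmodule = Submodule.span (PolyRing n) (Set.range r))
    (hreg : RingTheory.Sequence.IsWeaklyRegular (GrRing n p)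
      (List.ofFn fun i => symbol (o i) (r i : DiffOp n p))) :
    -- the Spencer complex over `R` is a free resolution of `R / R⟨r₁, …, r_m⟩`
    (∀ e, Module.Free (DiffOp n p) (SpR L e)) ∧
    (∀ e, Function.Exact (spencerRD L (e + 1)) (spencerRD L e)) ∧
    Function.Exact (spencerRD L 0)
      (spencerAug L (Submodule.span (DiffOp n p) (Set.range fun i => (r i : DiffOp n p)))) ∧
    Function.Surjective
      (spencerAug L (Submodule.span (DiffOp n p) (Set.range fun i => (r i : DiffOp n p)))) ∧
    -- the `rᵢ` form an involutive basis of `R⟨r₁, …, r_m⟩`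
    symbolIdeal (Submodule.span (DiffOp n p) (Set.range fun i => (r i : DiffOp n p)))
      = Ideal.span (Set.range fun i => symbol (o i) (r i : DiffOp n p)) := by
  obtain ⟨b, hb, h⟩ := exists_isAdapted_basis ho hr hindep L hL
  obtain rfl : r = fun i => (b i : F1 n p) := funext fun i => (hb i).symm
  exact ⟨fun e => Module.Free.of_basis (spRBasis b e), h.exact hreg, exact_spencerAug b,
    spencerAug_surjective _, h.symbolIdeal_eq hreg⟩
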